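/- \textbf{Setting.} Let $(\varepsilon_k)_{k\in\mathbb Z}$ be i.i.d.\ random elements of a measurable space $\mathbb S$, and let $g_h:\mathbb S^{\mathbb N}\to\mathbb R$, $h\ge 1$, be measurable maps such that $U_{k,h}=g_h(\varepsilon_k,\varepsilon_{k-1},\dots)$ is integrable with $E[U_{k,h}]=0$. For sample size $n$ one observes $X_{k,h}=\mu_{k,h}+U_{k,h}$, $1\le k\le n$, $1\le h\le d=d_n$, where the means $\mu_{k,h}$ may depend on $n$. For arrays $(c_h)$ write $\sup_h^*c_h=\limsup_{d\to\infty}\max_{h\le d}c_h$ and $\inf_h^*c_h=\liminf_{d\to\infty}\min_{h\le d}c_h$. With an independent copy $(\varepsilon_k')$ of $(\varepsilon_k)$ and $\|\cdot\|_p=E[|\cdot|^p]^{1/p}$, let $$a_k(p)=\sup_h^*\bigl\|g_h(\varepsilon_k,\dots,\varepsilon_0,\varepsilon_{-1},\dots)-g_h(\varepsilon_k,\dots,\varepsilon_0',\varepsilon_{-1},\dots)\bigr\|_p ,\qquad k\ge 0,$$ and let $\sigma_h\ge0$ with $\sigma_h^2=\lim_n n^{-1}E\bigl[\sum_{k,l=1}^nU_{k,h}U_{l,h}\bigr]$.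 \textbf{Assumption 1.} $p>4$, $a_k(p)\le A\max(k,1)^{-\mathfrak a}$ for all $k\ge0$, with constants $\mathfrak a>5/2$ and $A>0$, and $\inf_h^*\sigma_h\ge\sigma^-$ for some $\sigma^->0$. \textbf{Alternative.} For each coordinate $h$ (and $n$) let $\tau_h$ be a change fraction and $k_h^*=\lfloor\tau_hn\rfloor$. Let $\mathcal S_d^c$ be the set of $h\le d$ for which $\tau_h\in(0,1)$, $1\le k_h^*<n$ and $\mu_{1,h}=\dots=\mu_{k_h^*,h}\ne\mu_{k_h^*+1,h}=\dots=\mu_{n,h}$. The alternative $\mathcal H_A^{(\Delta\mu)}$ holds for sample size $n$ if $\mathcal S_d^c\neq\emptyset$ and $\mu_{1,h}=\dots=\mu_{n,h}$ for all remaining $h\le d$; then $\Delta\mu=\Delta\mu(n)=\min_{h\in\mathcal S_d^c}|\mu_{k_h^*,h}-\mu_{k_h^*+1,h}|$. \textbf{Estimators.} For $0<\mathfrak t\le 1/2$ let $\widehat\tau_h(\mathfrak t)$ be any choice of $$\widehat\tau_h(\mathfrak t)\in\operatorname*{arg\,max}_{t\in(\mathfrak t,1-\mathfrak t)}\; n^{-1/2}\Bigl|\sum_{j=1}^{\lceil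 nt\rceil}X_{j,h}-\frac{\lceil nt\rceil}{n}\sum_{j=1}^nX_{j,h}\Bigr| .$$ \textbf{Theorem.} Let $p>4$, $\mathfrak a>5/2$, $A>0$, $0<\mathfrak t\le1/2$. There is a constant $C_a>0$ depending only on $(p,\mathfrak a,A,\mathfrak t)$, and for every $D>0$ a constant $C>0$ depending only on $(p,\mathfrak a,A,\mathfrak t,D)$, such that the following holds for every model as above satisfying Assumption 1 and every $n_1\ge2$. Assume that for all $n\ge n_1$ the alternative $\mathcal H_A^{(\Delta\mu)}$ holds and $\mathfrak t<\inf_{h\in\mathcal S_d^c}\tau_h\le\sup_{h\in\mathcal S_d^c}\tau_h<1-\mathfrak t$, and that $\Delta\mu(n)$, $n\ge n_1$, is monotone decreasing with $\Delta\mu(n_1)\le D$. (i) For all $n\ge n_1$ and all $x\ge C_a\dfrac{\log n}{(\Delta\mu)^2n}$, $$P\Bigl(\max_{h\in\mathcal S_d^c}|\widehat\tau_h(\mathfrak t)-\tau_h|\ge x\Bigr)\le C\,|\mathcal S_d^c|\,(x\,n\log n)^{-p/2+2}.$$ (ii) If in addition $d_n=O(n^{\mathfrak d})$ with $0<\mathfrak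 d<p/2-2$, and $\lim_{n\to\infty}\frac{\log n}{(\Delta\mu)^2n}=0$, then $\max_{h\in\mathcal S_d^c}|\widehat\tau_h(\mathfrak t)-\tau_h|\to0$ in probability as $n\to\infty$. (If the maximum is not measurable, $P$ is read as outer probability.) -/

import Mathlib

open MeasureTheory ProbabilityTheory Filter Topology
open scoped ENNReal NNReal

noncomputable section

/-- `sup_h^* c_h = limsup_{d → ∞} max_{h < d} c_h` for an array `c d h`. -/
def supStar {α : Type*} [CompleteLattice α] (c : ℕ → ℕ → α) : α :=
  limsup (fun d : ℕ => ⨆ h : Fin d, c d h) atTop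

/-- `inf_h^* c_h = liminf_{d → ∞} min_{h < d} c_h` for an array `c d h`. -/
def infStar {α : Type*} [CompleteLattice α] (c : ℕ → ℕ → α) : α :=
  liminf (fun d : ℕ => ⨅ h : Fin d, c d h) atTop

/-- The causal past `(ε_k, ε_{k-1}, ε_{k-2}, …)` of a two-sided sequence. -/
def past {𝕊 : Type*} (e : ℤ → 𝕊) (k : ℤ) : ℕ → 𝕊 := fun j => e (k - j)

/-- The data of the change point model. Coordinates are numbered `0, 1, …`; for sample size `n` the
observed coordinates are those with `h < dim n`, and the observation times are `k = 1, …, n`. -/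
structure ChangePointModel (Ω 𝕊 : Type*) where
  /-- the innovations `ε_k`, `k ∈ ℤ` -/
  innov : ℤ → Ω → 𝕊
  /-- the maps `g_h` -/
  g : ℕ → (ℕ → 𝕊) → ℝ
  /-- the mean `μ_{k,h}` for sample size `n`, as `mean n k h` -/
  mean : ℕ → ℕ → ℕ → ℝ
  /-- the dimension `d = d_n` -/
  dim : ℕ → ℕ
  /-- the change fraction `τ_h` for sample size `n`, as `frac n h` -/
  frac : ℕ → ℕ → ℝ

namespace ChangePointModel

variable {Ω 𝕊 : Type*} (M : ChangePointModel Ω 𝕊)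

/-- The centred process `U_{k,h} = g_h(ε_k, ε_{k-1}, …)`. -/
def noise (k : ℤ) (h : ℕ) (ω : Ω) : ℝ := M.g h (past (fun i => M.innov i ω) k)

/-- The observation `X_{k,h} = μ_{k,h} + U_{k,h}` for sample size `n`. -/
def obs (n k h : ℕ) (ω : Ω) : ℝ := M.mean n k h + M.noise k h ω

/-- The `ε_k` are i.i.d., the `g_h` are measurable, and the noise has an expectation, equal to zero
(so that `mean n k h` is the expectation of the observation `obs n k h`). -/
structure IsRegular [MeasurableSpace Ω] [MeasurableSpace 𝕊] (P : Measure Ω) : Prop where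
  measurable_innov : ∀ k, Measurable (M.innov k)
  indep : iIndepFun M.innov P
  identDistrib : ∀ k, IdentDistrib (M.innov k) (M.innov 0) P P
  measurable_g : ∀ h, Measurable (M.g h)
  integrable : ∀ k h, Integrable (M.noise k h) P
  centered : ∀ k h, ∫ ω, M.noise k h ω ∂P = 0

/-- The temporal dependence measure
`a_k(p) = sup_h^* ‖g_h(ε_k, …, ε_0, ε_{-1}, …) - g_h(ε_k, …, ε_0', ε_{-1}, …)‖_p`.
The independent copy `ε'` of `ε` is realised on the second factor of `Ω × Ω`. -/
def depMeasure [MeasurableSpace Ω] (P : Measure Ω) (p : ℝ) (k : ℕ) : ℝ≥0∞ :=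
  supStar fun _ h => eLpNorm
    (fun w : Ω × Ω =>
      M.g h (past (fun i => M.innov i w.1) k) -
        M.g h (past (fun i => if i = 0 then M.innov 0 w.2 else M.innov i w.1) k))
    (ENNReal.ofReal p) (P.prod P)

/-- The long run covariance `γ_{i,j} = lim_n n⁻¹ E[∑_{k ≤ n} ∑_{l ≤ n} U_{k,i} U_{l,j}]`. -/
def longRunCov [MeasurableSpace Ω] (P : Measure Ω) (i j : ℕ) : ℝ :=
  limUnder atTop fun n : ℕ =>
    (n : ℝ)⁻¹ * ∫ ω, ∑ k ∈ Finset.Icc 1 n, ∑ l ∈ Finset.Icc 1 n,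
      M.noise k i ω * M.noise l j ω ∂P

/-- The long run standard deviation `σ_h = γ_{h,h}^{1/2}`. -/
def longRunSD [MeasurableSpace Ω] (P : Measure Ω) (h : ℕ) : ℝ := √(M.longRunCov P h h)

/-- The temporal assumptions with moment `p`, decay exponent `𝔞` and constant `A`:
`a_k(p) ≤ A k^{-𝔞}` for `k ≥ 1`, `a_0(p) ≤ A`, and `inf_h^* σ_h ≥ σ⁻` for some `σ⁻ > 0`. -/
structure TemporalAssumptions [MeasurableSpace Ω] (P : Measure Ω) (p 𝔞 A : ℝ) : Prop where
  decay : ∀ k : ℕ, M.depMeasure P p k ≤ ENNReal.ofReal (A * (max (k : ℝ) 1) ^ (-𝔞))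
  nondegenerate : ∃ σm : ℝ, 0 < σm ∧
    (σm : EReal) ≤ infStar fun _ h => ((M.longRunSD P h : ℝ) : EReal)

/-- The time lag of the change, `k_h^* = ⌊τ_h n⌋`. -/
def changeTime (n h : ℕ) : ℕ := ⌊M.frac n h * n⌋₊

/-- `H_{0,h}`: the mean of coordinate `h` is constant over `1, …, n`. -/
def NullAt (n h : ℕ) : Prop :=
  ∀ k ∈ Finset.Icc 1 n, ∀ l ∈ Finset.Icc 1 n, M.mean n k h = M.mean n l h

/-- `H_{A,h}`: `μ_{1,h} = ⋯ = μ_{k*,h} ≠ μ_{k*+1,h} = ⋯ = μ_{n,h}` with `k* = ⌊τ_h n⌋`,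
`τ_h ∈ (0,1)`, both segments being nonempty. -/
def ChangeAt (n h : ℕ) : Prop :=
  0 < M.frac n h ∧ M.frac n h < 1 ∧
  1 ≤ M.changeTime n h ∧ M.changeTime n h < n ∧
  (∀ k ∈ Finset.Icc 1 (M.changeTime n h), M.mean n k h = M.mean n (M.changeTime n h) h) ∧
  (∀ k ∈ Finset.Icc (M.changeTime n h + 1) n,
    M.mean n k h = M.mean n (M.changeTime n h + 1) h) ∧
  M.mean n (M.changeTime n h) h ≠ M.mean n (M.changeTime n h + 1) h

open Classical in
/-- `S_d^c`: the coordinates where a change has occurred. -/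
def changeSet (n : ℕ) : Finset ℕ := (Finset.range (M.dim n)).filter (M.ChangeAt n)

/-- `Δμ_h = |μ_{k*,h} - μ_{k*+1,h}|`. -/
def jump (n h : ℕ) : ℝ :=
  |M.mean n (M.changeTime n h) h - M.mean n (M.changeTime n h + 1) h|

/-- The minimal size of the change, `Δμ = min_{h ∈ S_d^c} Δμ_h`. -/
def minJump (n : ℕ) : ℝ := ⨅ h : M.changeSet n, M.jump n h

/-- `H_A` for sample size `n`: at least one coordinate has a change, and the null hypothesis holds
in all the unaffected coordinates. -/
def Alternative (n : ℕ) : Prop :=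
  (M.changeSet n).Nonempty ∧ ∀ h < M.dim n, M.NullAt n h ∨ M.ChangeAt n h

/-- `n^{-1/2} |∑_{j ≤ ⌈nt⌉} X_{j,h} - (⌈nt⌉ / n) ∑_{j ≤ n} X_{j,h}|`. -/
def cusum (n h : ℕ) (ω : Ω) (t : ℝ) : ℝ :=
  (n : ℝ) ^ (-(1 / 2) : ℝ) *
    |∑ j ∈ Finset.Icc 1 ⌈n * t⌉₊, M.obs n j h ω -
      (⌈n * t⌉₊ : ℝ) / n * ∑ j ∈ Finset.Icc 1 n, M.obs n j h ω|

/-- `s` is a value of `argmax_{t ∈ (𝔱, 1 - 𝔱)}` of the CUSUM function of coordinate `h`. -/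
def IsArgmaxCusum (𝔱 : ℝ) (n h : ℕ) (ω : Ω) (s : ℝ) : Prop :=
  s ∈ Set.Ioo 𝔱 (1 - 𝔱) ∧ IsMaxOn (M.cusum n h ω) (Set.Ioo 𝔱 (1 - 𝔱)) s

/-- `max_{h ∈ S_d^c} |τ̂_h - τ_h|`. -/
def maxError (τhat : ℕ → ℕ → Ω → ℝ) (n : ℕ) (ω : Ω) : ℝ :=
  ⨆ h : M.changeSet n, |τhat n h ω - M.frac n h|

end ChangePointModel

end

/-!
If `|τ̂ - τ| ≥ x`, the CUSUM statistic at `τ̂` is at least as large as at `τ`. Its deterministic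
part is the jump times a tent function with peak at the change, so the partial sums of the noise
have to make up for the decay of the tent: between the change time and a time at distance
`d ≥ nx - 1`, or over a whole initial segment, they move by at least a constant times `Δμ d`.

Such increments are unlikely by a Fuk–Nagaev inequality for causal processes. The process is split
into martingale differences, the `j`-th of which depends on the `j + 1` most recent innovations
only. A sum of functions of `q` consecutive innovations falls into `q` residue classes of
independent summands, and these obey the classical inequality, which follows from truncation and
Chernoff's bound. For a sum of length `m` this is done for `j < m`, and the contribution of the far
past is so small that its `p`-th moment is enough. The decay of the dependence coefficients makes
the levels `j` summable. The exponential terms are absorbed by the condition on `x`, the polynomial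
ones add up over `d` to `(x n log n)^(-p/2+2)`.

If `n x` is bounded, the condition on `x` bounds `log n` in terms of `D`, and the probability bound
holds because its right-hand side is at least one for a suitable constant.
-/

section ExpBound

lemma exp_le_rpow_mul_exp {p u v : ℝ} (hp : 1 ≤ p) (hu : 1 ≤ u) (huv : u ≤ v) :
    Real.exp u ≤ p ^ p * (u / v) ^ p * Real.exp v := by
  have hp₀ : 0 < p := by linarith
  have hu₀ : 0 < u := by linarith
  have hv₀ : 0 < v := by linarith
  have h_ratio : v / u ≤ p * Real.exp ((v - u) / p) := by
    calc v / u ≤ 1 + (v - u) := by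
          rw [div_le_iff₀ hu₀]
          nlinarith
      _ ≤ p * ((v - u) / p + 1) := by
          rw [mul_add, mul_div_cancel₀ _ hp₀.ne']
          linarith
      _ ≤ p * Real.exp ((v - u) / p) := by gcongr; exact Real.add_one_le_exp _
  have h_pow : (v / u) ^ p ≤ p ^ p * Real.exp (v - u) := by
    calc (v / u) ^ p ≤ (p * Real.exp ((v - u) / p)) ^ p := by gcongr
      _ = p ^ p * Real.exp (v - u) := by
        rw [Real.mul_rpow hp₀.le (Real.exp_pos _).le, ← Real.exp_mul, div_mul_cancel₀ _ hp₀.ne']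
  calc Real.exp u = (v / u) ^ p * (u / v) ^ p * Real.exp u := by
        rw [← Real.mul_rpow (by positivity) (by positivity), div_mul_div_cancel₀ hu₀.ne',
          div_self hv₀.ne', Real.one_rpow, one_mul]
    _ ≤ p ^ p * Real.exp (v - u) * (u / v) ^ p * Real.exp u := by gcongr
    _ = p ^ p * (u / v) ^ p * (Real.exp (v - u) * Real.exp u) := by ring
    _ = p ^ p * (u / v) ^ p * Real.exp v := by rw [← Real.exp_add, sub_add_cancel]

lemma exp_le_quadratic_add_rpow {p u v : ℝ} (hp : 1 ≤ p) (hv : 0 < v) (huv : u ≤ v) :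
    Real.exp u ≤ 1 + u + u ^ 2 + p ^ p * (|u| / v) ^ p * Real.exp v := by
  have h_nonneg : 0 ≤ p ^ p * (|u| / v) ^ p * Real.exp v := by positivity
  rcases le_or_gt u (-1) with h_neg | h_neg
  · have : Real.exp u ≤ 1 := Real.exp_le_one_iff.2 (by linarith)
    nlinarith
  rcases le_or_gt u 1 with h_one | h_one
  · have := (abs_le.1 (Real.abs_exp_sub_one_sub_id_le (abs_le.2 ⟨h_neg.le, h_one⟩))).2
    linarith
  · have := exp_le_rpow_mul_exp hp h_one.le huv
    rw [abs_of_pos (by linarith)]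
    nlinarith

end ExpBound

section Moments

variable {Ω : Type*} [MeasurableSpace Ω] {P : Measure Ω} {p s : ℝ} {Y : Ω → ℝ}

lemma integrable_abs_rpow_of_eLpNorm_le (hp : 0 < p) (hY : AEStronglyMeasurable Y P)
    (hs : eLpNorm Y (ENNReal.ofReal p) P ≤ ENNReal.ofReal s) :
    Integrable (fun ω => |Y ω| ^ p) P := by
  have hLp : MemLp Y (ENNReal.ofReal p) P := ⟨hY, hs.trans_lt ENNReal.ofReal_lt_top⟩
  simpa [ENNReal.toReal_ofReal hp.le] using
    hLp.integrable_norm_rpow (by simpa using hp) ENNReal.ofReal_ne_top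

lemma integral_abs_rpow_le_of_eLpNorm_le (hp : 0 < p) (hs₀ : 0 ≤ s)
    (hY : AEStronglyMeasurable Y P)
    (hs : eLpNorm Y (ENNReal.ofReal p) P ≤ ENNReal.ofReal s) :
    ∫ ω, |Y ω| ^ p ∂P ≤ s ^ p := by
  have hLp : MemLp Y (ENNReal.ofReal p) P := ⟨hY, hs.trans_lt ENNReal.ofReal_lt_top⟩
  rw [hLp.eLpNorm_eq_integral_rpow_norm (by simpa using hp) ENNReal.ofReal_ne_top,
    ENNReal.ofReal_le_ofReal_iff hs₀, ENNReal.toReal_ofReal hp.le] at hs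
  exact (Real.rpow_inv_le_iff_of_pos (integral_nonneg fun ω => by positivity) hs₀ hp).1 hs

lemma measureReal_abs_ge_le_of_eLpNorm_le [IsFiniteMeasure P] {y : ℝ} (hp : 0 < p) (hs₀ : 0 ≤ s)
    (hy : 0 < y) (hY : AEStronglyMeasurable Y P)
    (hs : eLpNorm Y (ENNReal.ofReal p) P ≤ ENNReal.ofReal s) :
    P.real {ω | y ≤ |Y ω|} ≤ s ^ p / y ^ p := by
  have h_markov := mul_meas_ge_le_integral_of_nonneg (μ := P)
    (Eventually.of_forall fun ω => (by positivity : 0 ≤ |Y ω| ^ p))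
    (integrable_abs_rpow_of_eLpNorm_le hp hY hs) (y ^ p)
  simp only [Real.rpow_le_rpow_iff hy.le (abs_nonneg _) hp] at h_markov
  rw [le_div_iff₀ (by positivity), mul_comm]
  exact h_markov.trans (integral_abs_rpow_le_of_eLpNorm_le hp hs₀ hY hs)

end Moments

section FukNagaev

/-- The truncation of `x` from above at level `M`: values exceeding `M` are replaced by `0`. It
makes a random variable with finite `p`-th moment amenable to exponential moment bounds. -/
noncomputable def truncAbove (M x : ℝ) : ℝ := if x ≤ M then x else 0

lemma truncAbove_of_le {M x : ℝ} (h : x ≤ M) : truncAbove M x = x := if_pos h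

lemma truncAbove_le {M : ℝ} (hM : 0 ≤ M) (x : ℝ) : truncAbove M x ≤ M := by
  unfold truncAbove
  split_ifs with h
  exacts [h, hM]

lemma measurable_truncAbove (M : ℝ) : Measurable (truncAbove M) :=
  Measurable.ite measurableSet_Iic measurable_id measurable_const

lemma exp_mul_truncAbove_le {p l M : ℝ} (hp : 1 ≤ p) (hl : 0 < l) (hM : 0 < M) (x : ℝ) :
    Real.exp (l * truncAbove M x) ≤
      1 + l * x + l ^ 2 * x ^ 2 + p ^ p * Real.exp (l * M) / M ^ p * |x| ^ p := by
  have h_nonneg : 0 ≤ p ^ p * Real.exp (l * M) / M ^ p * |x| ^ p := by positivity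
  unfold truncAbove
  split_ifs with h
  · have h_exp := exp_le_quadratic_add_rpow hp (mul_pos hl hM) (mul_le_mul_of_nonneg_left h hl.le)
    rw [abs_mul, abs_of_pos hl, mul_div_mul_left _ _ hl.ne', Real.div_rpow (abs_nonneg _) hM.le,
      mul_pow] at h_exp
    exact h_exp.trans_eq (by ring)
  · have : 0 ≤ l * x := mul_nonneg hl.le (by linarith)
    rw [mul_zero, Real.exp_zero]
    nlinarith [sq_nonneg (l * x)]

variable {Ω : Type*} [MeasurableSpace Ω] {P : Measure Ω} [IsProbabilityMeasure P]

lemma mgf_truncAbove_le {p s M l : ℝ} (hp : 2 ≤ p) (hs₀ : 0 ≤ s) (hM : 0 < M) (hl : 0 < l)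
    {Y : Ω → ℝ} (hY : AEStronglyMeasurable Y P) (hY₀ : ∫ ω, Y ω ∂P = 0)
    (hs : eLpNorm Y (ENNReal.ofReal p) P ≤ ENNReal.ofReal s) :
    mgf (fun ω => truncAbove M (Y ω)) P l ≤
      Real.exp (l ^ 2 * s ^ 2 + p ^ p * (s / M) ^ p * Real.exp (l * M)) := by
  have hp₀ : 0 < p := by linarith
  have hLp : MemLp Y (ENNReal.ofReal p) P := ⟨hY, hs.trans_lt ENNReal.ofReal_lt_top⟩
  have hs₂ : eLpNorm Y (ENNReal.ofReal 2) P ≤ ENNReal.ofReal s :=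
    (eLpNorm_le_eLpNorm_of_exponent_le (ENNReal.ofReal_le_ofReal hp) hY).trans hs
  have h_int₁ : Integrable Y P := hLp.integrable (by simpa using by linarith)
  have h_int₂ := integrable_abs_rpow_of_eLpNorm_le two_pos hY hs₂
  have h_le₂ := integral_abs_rpow_le_of_eLpNorm_le two_pos hs₀ hY hs₂
  have h_intp := integrable_abs_rpow_of_eLpNorm_le hp₀ hY hs
  have h_lep := integral_abs_rpow_le_of_eLpNorm_le hp₀ hs₀ hY hs
  simp only [Real.rpow_two, sq_abs] at h_int₂ h_le₂
  set K : ℝ := p ^ p * Real.exp (l * M) / M ^ p with hK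
  have hI₁ : Integrable (fun ω => 1 + l * Y ω) P := (integrable_const 1).add (h_int₁.const_mul l)
  have hI₂ : Integrable (fun ω => 1 + l * Y ω + l ^ 2 * Y ω ^ 2) P :=
    hI₁.add (h_int₂.const_mul (l ^ 2))
  calc mgf (fun ω => truncAbove M (Y ω)) P l
      ≤ ∫ ω, (1 + l * Y ω + l ^ 2 * Y ω ^ 2 + K * |Y ω| ^ p) ∂P :=
        integral_mono_of_nonneg (Eventually.of_forall fun ω => (Real.exp_pos _).le)
          (hI₂.add (h_intp.const_mul K))
          (Eventually.of_forall fun ω => exp_mul_truncAbove_le (by linarith) hl hM (Y ω))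
    _ = 1 + l ^ 2 * ∫ ω, Y ω ^ 2 ∂P + K * ∫ ω, |Y ω| ^ p ∂P := by
        rw [integral_add hI₂ (h_intp.const_mul K), integral_add hI₁ (h_int₂.const_mul (l ^ 2)),
          integral_add (integrable_const 1) (h_int₁.const_mul l),
          integral_const_mul, integral_const_mul, integral_const_mul, hY₀]
        simp
    _ ≤ 1 + l ^ 2 * s ^ 2 + K * s ^ p := by gcongr
    _ = (l ^ 2 * s ^ 2 + p ^ p * (s / M) ^ p * Real.exp (l * M)) + 1 := by
        rw [Real.div_rpow hs₀ hM.le, hK]; ring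
    _ ≤ _ := Real.add_one_le_exp _

lemma exists_exponential_tilt {v y b : ℝ} (hv : 0 < v) (hy : 0 < y) (hb₀ : 0 < b) (hb₁ : b < 1) :
    ∃ l > 0, l * (2 * v) ≤ y ∧ Real.exp (l * (y / 2)) ≤ b⁻¹ ∧
      Real.exp (-(l * (y / 2))) ≤ b + Real.exp (-(y ^ 2 / (4 * v))) := by
  have h_log : 0 < Real.log b⁻¹ := Real.log_pos ((one_lt_inv₀ hb₀).2 hb₁)
  refine ⟨min (y / (2 * v)) (Real.log b⁻¹ / (y / 2)), by positivity, ?_, ?_, ?_⟩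
  · rw [← le_div_iff₀ (by positivity)]
    exact min_le_left _ _
  · rw [← Real.le_log_iff_exp_le (by positivity), ← le_div_iff₀ (by positivity)]
    exact min_le_right _ _
  · rcases min_choice (y / (2 * v)) (Real.log b⁻¹ / (y / 2)) with h | h <;> rw [h]
    · have : y / (2 * v) * (y / 2) = y ^ 2 / (4 * v) := by field_simp; ring
      rw [this]
      linarith
    · rw [div_mul_cancel₀ _ (by positivity), Real.log_inv, neg_neg, Real.exp_log hb₀]
      linarith [Real.exp_pos (-(y ^ 2 / (4 * v)))]

variable {ι : Type*} [Fintype ι] {p s N y : ℝ} {Y : ι → Ω → ℝ}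

lemma integrable_exp_mul_sum_truncAbove {l M : ℝ} (hl : 0 ≤ l) (hM : 0 ≤ M)
    (hY_meas : ∀ i, Measurable (Y i)) :
    Integrable (fun ω => Real.exp (l * (∑ i, truncAbove M ∘ Y i) ω)) P := by
  simp only [Finset.sum_apply, Function.comp_apply]
  have h_meas : Measurable fun ω => ∑ i, truncAbove M (Y i ω) :=
    Finset.measurable_sum _ fun i _ => (measurable_truncAbove M).comp (hY_meas i)
  refine Integrable.of_bound (C := Real.exp (l * ∑ _i : ι, M))
    (h_meas.const_mul l).exp.aestronglyMeasurable (Eventually.of_forall fun ω => ?_)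
  rw [Real.norm_eq_abs, Real.abs_exp]
  gcongr
  exact truncAbove_le hM _

lemma measureReal_sum_truncAbove_ge_le (hp : 2 ≤ p) (hs₀ : 0 < s) (hN : 0 < N) (hy : 0 < y)
    (h_small : N * s ^ p / y ^ p < 1) (h_card : (Fintype.card ι : ℝ) ≤ N)
    (hY_meas : ∀ i, Measurable (Y i)) (h_indep : iIndepFun Y P) (hY₀ : ∀ i, ∫ ω, Y i ω ∂P = 0)
    (hs : ∀ i, eLpNorm (Y i) (ENNReal.ofReal p) P ≤ ENNReal.ofReal s) :
    P.real {ω | y ≤ ∑ i, truncAbove (y / 2) (Y i ω)} ≤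
      Real.exp (p ^ p * 2 ^ p) * (N * s ^ p / y ^ p + Real.exp (-(y ^ 2 / (4 * (N * s ^ 2))))) := by
  obtain ⟨l, hl, hl_var, hl_exp, hl_tail⟩ :=
    exists_exponential_tilt (v := N * s ^ 2) (by positivity) hy (by positivity) h_small
  set b := N * s ^ p / y ^ p with hb
  set q := l ^ 2 * s ^ 2 + p ^ p * (s / (y / 2)) ^ p * Real.exp (l * (y / 2)) with hq
  have h_mgf : mgf (∑ i, truncAbove (y / 2) ∘ Y i) P l ≤ Real.exp (N * q) := by
    have h_meas i := (measurable_truncAbove (y / 2)).comp (hY_meas i)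
    rw [(h_indep.comp _ fun _ => measurable_truncAbove (y / 2)).mgf_sum h_meas]
    calc _ ≤ ∏ _i : ι, Real.exp q := Finset.prod_le_prod (fun i _ => mgf_nonneg) fun i _ =>
          mgf_truncAbove_le hp hs₀.le (by positivity) hl (hY_meas i).aestronglyMeasurable (hY₀ i)
            (hs i)
      _ = Real.exp (Fintype.card ι * q) := by simp [Real.exp_nat_mul]
      _ ≤ Real.exp (N * q) := by gcongr
  have h_heavy : N * (p ^ p * (s / (y / 2)) ^ p * Real.exp (l * (y / 2))) ≤ p ^ p * 2 ^ p := by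
    calc _ ≤ N * (p ^ p * (s / (y / 2)) ^ p * b⁻¹) := by gcongr
      _ = p ^ p * 2 ^ p := by
        rw [hb, Real.div_rpow hs₀.le (by positivity), Real.div_rpow hy.le two_pos.le]
        field_simp
  have h_exponent : -l * y + N * q ≤ p ^ p * 2 ^ p + -(l * (y / 2)) := by
    rw [hq]
    nlinarith
  have h_chernoff := measure_ge_le_exp_mul_mgf (μ := P) y hl.le
    (integrable_exp_mul_sum_truncAbove hl.le (by positivity : 0 ≤ y / 2) hY_meas)
  simp only [Finset.sum_apply, Function.comp_apply] at h_chernoff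
  calc P.real {ω | y ≤ ∑ i, truncAbove (y / 2) (Y i ω)}
      ≤ Real.exp (-l * y) * Real.exp (N * q) := h_chernoff.trans (by gcongr)
    _ ≤ Real.exp (p ^ p * 2 ^ p + -(l * (y / 2))) := by rw [← Real.exp_add]; gcongr
    _ = Real.exp (p ^ p * 2 ^ p) * Real.exp (-(l * (y / 2))) := Real.exp_add _ _
    _ ≤ _ := by gcongr

omit [IsProbabilityMeasure P] in
lemma measureReal_iUnion_abs_ge_le [IsFiniteMeasure P] (hp : 0 < p) (hs₀ : 0 ≤ s) (hy : 0 < y)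
    (h_card : (Fintype.card ι : ℝ) ≤ N) (hY : ∀ i, AEStronglyMeasurable (Y i) P)
    (hs : ∀ i, eLpNorm (Y i) (ENNReal.ofReal p) P ≤ ENNReal.ofReal s) :
    P.real (⋃ i, {ω | y ≤ |Y i ω|}) ≤ N * (s ^ p / y ^ p) := by
  calc P.real (⋃ i, {ω | y ≤ |Y i ω|}) ≤ ∑ i, P.real {ω | y ≤ |Y i ω|} :=
        measureReal_iUnion_fintype_le _
    _ ≤ ∑ _i : ι, s ^ p / y ^ p := Finset.sum_le_sum fun i _ =>
        measureReal_abs_ge_le_of_eLpNorm_le hp hs₀ hy (hY i) (hs i)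
    _ = Fintype.card ι * (s ^ p / y ^ p) := by simp
    _ ≤ N * (s ^ p / y ^ p) := by gcongr

/-- The constant in the Fuk–Nagaev inequality for sums of independent random variables. The first
summand comes from the union bound, the second one from Chernoff's bound. -/
noncomputable def fukNagaevConst (p : ℝ) : ℝ := 2 ^ p + Real.exp (p ^ p * 2 ^ p)

lemma one_le_fukNagaevConst {p : ℝ} (hp : 0 ≤ p) : 1 ≤ fukNagaevConst p := by
  have h_two : (1 : ℝ) ≤ 2 ^ p := Real.one_le_rpow one_le_two hp
  unfold fukNagaevConst
  linarith [Real.exp_pos (p ^ p * 2 ^ p)]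

theorem measureReal_sum_ge_le_fukNagaev (hp : 2 ≤ p) (hs₀ : 0 < s) (hN : 0 < N) (hy : 0 < y)
    (h_card : (Fintype.card ι : ℝ) ≤ N) (hY_meas : ∀ i, Measurable (Y i))
    (h_indep : iIndepFun Y P) (hY₀ : ∀ i, ∫ ω, Y i ω ∂P = 0)
    (hs : ∀ i, eLpNorm (Y i) (ENNReal.ofReal p) P ≤ ENNReal.ofReal s) :
    P.real {ω | y ≤ ∑ i, Y i ω} ≤
      fukNagaevConst p * (N * s ^ p / y ^ p + Real.exp (-(y ^ 2 / (4 * (N * s ^ 2))))) := by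
  have hp₀ : 0 < p := by linarith
  have h_exp := Real.exp_pos (-(y ^ 2 / (4 * (N * s ^ 2))))
  rcases le_or_gt 1 (N * s ^ p / y ^ p) with h_large | h_small
  · calc P.real {ω | y ≤ ∑ i, Y i ω} ≤ 1 := measureReal_le_one
      _ ≤ _ := by nlinarith [one_le_fukNagaevConst hp₀.le]
  have h_subset : {ω | y ≤ ∑ i, Y i ω} ⊆
      (⋃ i, {ω | y / 2 ≤ |Y i ω|}) ∪ {ω | y ≤ ∑ i, truncAbove (y / 2) (Y i ω)} := by
    intro ω hω
    by_cases h_jump : ∃ i, y / 2 ≤ |Y i ω|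
    · exact Or.inl (Set.mem_iUnion.2 h_jump)
    · push Not at h_jump
      have h_trunc i : truncAbove (y / 2) (Y i ω) = Y i ω :=
        truncAbove_of_le ((le_abs_self _).trans (h_jump i).le)
      exact Or.inr (by simpa [h_trunc] using hω)
  have h_jump : P.real (⋃ i, {ω | y / 2 ≤ |Y i ω|}) ≤ 2 ^ p * (N * s ^ p / y ^ p) := by
    refine (measureReal_iUnion_abs_ge_le hp₀ hs₀.le (by positivity) h_card
      (fun i => (hY_meas i).aestronglyMeasurable) hs).trans_eq ?_
    rw [Real.div_rpow hy.le two_pos.le]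
    field_simp
  calc P.real {ω | y ≤ ∑ i, Y i ω} ≤ _ := measureReal_mono h_subset
    _ ≤ _ := measureReal_union_le _ _
    _ ≤ _ := add_le_add h_jump
      (measureReal_sum_truncAbove_ge_le hp hs₀ hN hy h_small h_card hY_meas h_indep hY₀ hs)
    _ ≤ _ := by
      unfold fukNagaevConst
      nlinarith [Real.rpow_pos_of_pos two_pos p]

theorem measureReal_abs_sum_ge_le_fukNagaev (hp : 2 ≤ p) (hs₀ : 0 < s) (hN : 0 < N) (hy : 0 < y)
    (h_card : (Fintype.card ι : ℝ) ≤ N) (hY_meas : ∀ i, Measurable (Y i))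
    (h_indep : iIndepFun Y P) (hY₀ : ∀ i, ∫ ω, Y i ω ∂P = 0)
    (hs : ∀ i, eLpNorm (Y i) (ENNReal.ofReal p) P ≤ ENNReal.ofReal s) :
    P.real {ω | y ≤ |∑ i, Y i ω|} ≤
      2 * fukNagaevConst p * (N * s ^ p / y ^ p + Real.exp (-(y ^ 2 / (4 * (N * s ^ 2))))) := by
  have h_pos := measureReal_sum_ge_le_fukNagaev hp hs₀ hN hy h_card hY_meas h_indep hY₀ hs
  have h_neg := measureReal_sum_ge_le_fukNagaev (P := P) hp hs₀ hN hy h_card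
    (Y := fun i => -Y i) (fun i => (hY_meas i).neg)
    (h_indep.comp (fun _ x => -x) fun _ => measurable_neg)
    (fun i => by simp only [Pi.neg_apply, integral_neg, hY₀, neg_zero])
    (fun i => by simpa only [eLpNorm_neg] using hs i)
  have h_subset : {ω | y ≤ |∑ i, Y i ω|} ⊆
      {ω | y ≤ ∑ i, Y i ω} ∪ {ω | y ≤ ∑ i, (-Y i) ω} := by
    intro ω hω
    simpa [le_abs] using hω
  calc _ ≤ _ := measureReal_mono h_subset
    _ ≤ _ := measureReal_union_le _ _
    _ ≤ _ := add_le_add h_pos h_neg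
    _ = _ := by ring

end FukNagaev

section Splice

open scoped Classical in
lemma measurePreserving_piecewise {ι : Type*} {X : ι → Type*} [∀ i, MeasurableSpace (X i)]
    (μ : ∀ i, Measure (X i)) [∀ i, IsProbabilityMeasure (μ i)] (s : Set ι) :
    MeasurePreserving (fun q : (∀ i, X i) × (∀ i, X i) => s.piecewise q.1 q.2)
      ((Measure.infinitePi μ).prod (Measure.infinitePi μ)) (Measure.infinitePi μ) := by
  have h_meas : Measurable fun q : (∀ i, X i) × (∀ i, X i) => s.piecewise q.1 q.2 := by
    refine measurable_pi_lambda _ fun i => ?_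
    unfold Set.piecewise
    split_ifs <;> fun_prop
  refine ⟨h_meas, Measure.eq_infinitePi _ fun S t ht => ?_⟩
  have h_preimage : (fun q : (∀ i, X i) × (∀ i, X i) => s.piecewise q.1 q.2) ⁻¹' (Set.pi S t) =
      (Set.pi (S.filter (· ∈ s) : Finset ι) t) ×ˢ (Set.pi (S.filter (· ∉ s) : Finset ι) t) := by
    ext q
    simp only [Set.mem_preimage, Set.mem_pi, Set.mem_prod, Finset.mem_coe, Finset.mem_filter,
      Set.piecewise, and_imp, ← forall_and]
    exact forall₂_congr fun i _ => by split_ifs with hi <;> simp [hi]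
  rw [Measure.map_apply h_meas (MeasurableSet.pi S.countable_toSet fun i _ => ht i), h_preimage,
    Measure.prod_prod, Measure.infinitePi_pi _ fun i _ => ht i,
    Measure.infinitePi_pi _ fun i _ => ht i]
  exact Finset.prod_filter_mul_prod_filter_not S _ _

variable {𝕊 : Type*}

/-- The sequence with entries `x i` for `i < j` and `z i` for `i ≥ j`. For a past sequence `x` and
an independent copy `z` of it, everything but the `j` most recent innovations is resampled. -/
def splice (j : ℕ) (x z : ℕ → 𝕊) : ℕ → 𝕊 := (Set.Iio j).piecewise x z

lemma splice_zero (x z : ℕ → 𝕊) : splice 0 x z = z := by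
  ext i
  simp [splice]

lemma dependsOn_splice (j : ℕ) (z : ℕ → 𝕊) : DependsOn (splice j · z) (Set.Iio j) := by
  intro x x' h
  ext i
  simp only [splice, Set.piecewise]
  split_ifs with hi
  exacts [h i hi, rfl]

lemma splice_update (j : ℕ) (x z : ℕ → 𝕊) (a : 𝕊) :
    splice j x (Function.update z j a) = Function.update (splice (j + 1) x z) j a := by
  ext i
  simp only [splice, Set.piecewise, Set.mem_Iio, Function.update_apply]
  split_ifs <;> first | rfl | omega

variable [MeasurableSpace 𝕊]

@[fun_prop]
lemma measurable_splice (j : ℕ) :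
    Measurable fun q : (ℕ → 𝕊) × (ℕ → 𝕊) => splice j q.1 q.2 := by
  refine measurable_pi_lambda _ fun i => ?_
  unfold splice Set.piecewise
  split_ifs <;> fun_prop

@[fun_prop]
lemma measurable_update_prod (j : ℕ) :
    Measurable fun q : (ℕ → 𝕊) × 𝕊 => Function.update q.1 j q.2 := by
  refine measurable_pi_lambda _ fun i => ?_
  simp only [Function.update_apply]
  split_ifs <;> fun_prop

variable (ν : Measure 𝕊)

/-- The law of an i.i.d. sequence with marginal `ν`; `ν` has to be a probability measure for the
product measure not to be a junk value. -/
noncomputable abbrev iidLaw : Measure (ℕ → 𝕊) := Measure.infinitePi fun _ : ℕ => ν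

/-- The physical dependence coefficient of lag `j`: the `L^p` distance between `g x` and the value
of `g` when the coordinate `x j` is replaced by an independent copy. -/
noncomputable def dependenceCoeff (g : (ℕ → 𝕊) → ℝ) (p : ℝ) (j : ℕ) : ℝ≥0∞ :=
  eLpNorm (fun w : (ℕ → 𝕊) × 𝕊 => g w.1 - g (Function.update w.1 j w.2)) (ENNReal.ofReal p)
    ((iidLaw ν).prod ν)

variable [IsProbabilityMeasure ν]

lemma measurePreserving_splice (j : ℕ) :
    MeasurePreserving (fun q : (ℕ → 𝕊) × (ℕ → 𝕊) => splice j q.1 q.2)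
      ((iidLaw ν).prod (iidLaw ν)) (iidLaw ν) := by
  unfold splice
  convert measurePreserving_piecewise (fun _ : ℕ => ν) (Set.Iio j)

lemma measurePreserving_update (j : ℕ) :
    MeasurePreserving (fun q : (ℕ → 𝕊) × 𝕊 => Function.update q.1 j q.2)
      ((iidLaw ν).prod ν) (iidLaw ν) := by
  refine ⟨measurable_update_prod j, ?_⟩
  have h_eval : MeasurePreserving (Prod.map id (Function.eval j))
      ((iidLaw ν).prod (iidLaw ν)) ((iidLaw ν).prod ν) :=
    (MeasurePreserving.id _).prod (measurePreserving_eval_infinitePi (fun _ => ν) j)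
  have h_swap := (measurePreserving_piecewise (fun _ : ℕ => ν) {j}ᶜ).map_eq
  rw [← h_eval.map_eq, Measure.map_map (measurable_update_prod j) h_eval.measurable]
  convert h_swap using 2
  ext q i
  by_cases hi : i = j <;> simp [hi, Set.piecewise]

lemma measurePreserving_splice_prod (j : ℕ) :
    MeasurePreserving (fun q : (ℕ → 𝕊) × ((ℕ → 𝕊) × 𝕊) => (splice j q.1 q.2.1, q.2.2))
      ((iidLaw ν).prod ((iidLaw ν).prod ν)) ((iidLaw ν).prod ν) :=
  ((measurePreserving_splice ν j).prod (MeasurePreserving.id ν)).comp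
    ((measurePreserving_prodAssoc (iidLaw ν) (iidLaw ν) ν).symm _)

end Splice

lemma eLpNorm_integral_prod_le {α β : Type*} [MeasurableSpace α] [MeasurableSpace β]
    {μ : Measure α} {Q : Measure β} [IsProbabilityMeasure Q] {p : ℝ} (hp : 1 ≤ p)
    {F : α × β → ℝ} (hF : Measurable F) :
    eLpNorm (fun x => ∫ w, F (x, w) ∂Q) (ENNReal.ofReal p) μ ≤
      eLpNorm F (ENNReal.ofReal p) (μ.prod Q) := by
  have hp₀ : 0 < p := by linarith
  have h_ne_zero : ENNReal.ofReal p ≠ 0 := by simpa using hp₀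
  rw [eLpNorm_eq_lintegral_rpow_enorm_toReal h_ne_zero ENNReal.ofReal_ne_top,
    eLpNorm_eq_lintegral_rpow_enorm_toReal h_ne_zero ENNReal.ofReal_ne_top,
    ENNReal.toReal_ofReal hp₀.le, lintegral_prod _ (by fun_prop)]
  gcongr with x
  have h_jensen : eLpNorm (fun w => F (x, w)) 1 Q ≤
      eLpNorm (fun w => F (x, w)) (ENNReal.ofReal p) Q :=
    eLpNorm_le_eLpNorm_of_exponent_le (by simpa using hp)
      (hF.comp measurable_prodMk_left).aestronglyMeasurable
  rw [eLpNorm_one_eq_lintegral_enorm, eLpNorm_eq_lintegral_rpow_enorm_toReal h_ne_zero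
    ENNReal.ofReal_ne_top, ENNReal.toReal_ofReal hp₀.le] at h_jensen
  calc ‖∫ w, F (x, w) ∂Q‖ₑ ^ p ≤ (∫⁻ w, ‖F (x, w)‖ₑ ∂Q) ^ p := by
        gcongr
        exact enorm_integral_le_lintegral_enorm _
    _ ≤ ((∫⁻ w, ‖F (x, w)‖ₑ ^ p ∂Q) ^ (1 / p)) ^ p := by gcongr
    _ = ∫⁻ w, ‖F (x, w)‖ₑ ^ p ∂Q := by
        rw [← ENNReal.rpow_mul, one_div_mul_cancel hp₀.ne', ENNReal.rpow_one]

section HeadMean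

variable {𝕊 : Type*} [MeasurableSpace 𝕊] (ν : Measure 𝕊)

/-- The conditional expectation of `g` given the coordinates `i < j`, as an everywhere defined
function: the remaining coordinates are integrated out. -/
noncomputable def headMean (g : (ℕ → 𝕊) → ℝ) (j : ℕ) (x : ℕ → 𝕊) : ℝ :=
  ∫ z, g (splice j x z) ∂(iidLaw ν)

/-- The martingale difference of `headMean`: its increment when coordinate `j` is revealed. -/
noncomputable def headDiff (g : (ℕ → 𝕊) → ℝ) (j : ℕ) (x : ℕ → 𝕊) : ℝ :=
  headMean ν g (j + 1) x - headMean ν g j x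

lemma dependsOn_headMean (g : (ℕ → 𝕊) → ℝ) (j : ℕ) : DependsOn (headMean ν g j) (Set.Iio j) := by
  intro x x' h
  simp only [headMean, dependsOn_splice j _ h]

lemma dependsOn_headDiff (g : (ℕ → 𝕊) → ℝ) (j : ℕ) :
    DependsOn (headDiff ν g j) (Set.Iio (j + 1)) := by
  intro x x' h
  simp only [headDiff, dependsOn_headMean ν g (j + 1) h,
    dependsOn_headMean ν g j fun i hi => h i (Set.Iio_subset_Iio j.le_succ hi)]

lemma headMean_zero (g : (ℕ → 𝕊) → ℝ) (x : ℕ → 𝕊) : headMean ν g 0 x = ∫ z, g z ∂(iidLaw ν) := by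
  simp only [headMean, splice_zero]

lemma headMean_indicator (g : (ℕ → 𝕊) → ℝ) {j : ℕ} {s : Set (ℕ → 𝕊)}
    (hs : DependsOn (· ∈ s) (Set.Iio j)) :
    headMean ν (s.indicator g) j = s.indicator (headMean ν g j) := by
  ext x
  have h_mem z : splice j x z ∈ s ↔ x ∈ s :=
    (hs fun i hi => Set.piecewise_eq_of_mem _ _ _ hi).to_iff
  by_cases hx : x ∈ s <;> simp [headMean, Set.indicator, h_mem, hx]

lemma sum_headDiff_add (g : (ℕ → 𝕊) → ℝ) (J n : ℕ) (x : ℕ → 𝕊) :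
    ∑ j ∈ Finset.range n, headDiff ν g (J + j) x = headMean ν g (J + n) x - headMean ν g J x :=
  Finset.sum_range_sub (fun j => headMean ν g (J + j) x) n

variable {ν} {g : (ℕ → 𝕊) → ℝ}

lemma sum_headDiff (hg₀ : ∫ z, g z ∂(iidLaw ν) = 0) (J : ℕ) (x : ℕ → 𝕊) :
    ∑ j ∈ Finset.range J, headDiff ν g j x = headMean ν g J x := by
  simpa [headMean_zero, hg₀] using sum_headDiff_add ν g 0 J x

variable [IsProbabilityMeasure ν]

lemma measurable_headMean (hg : Measurable g) (j : ℕ) : Measurable (headMean ν g j) := by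
  have h_meas : StronglyMeasurable fun q : (ℕ → 𝕊) × (ℕ → 𝕊) => g (splice j q.1 q.2) :=
    (hg.comp (measurable_splice j)).stronglyMeasurable
  exact h_meas.integral_prod_right.measurable

lemma measurable_headDiff (hg : Measurable g) (j : ℕ) : Measurable (headDiff ν g j) :=
  (measurable_headMean hg _).sub (measurable_headMean hg _)

lemma integrable_splice (hg : Integrable g (iidLaw ν)) (j : ℕ) :
    Integrable (fun q : (ℕ → 𝕊) × (ℕ → 𝕊) => g (splice j q.1 q.2))
      ((iidLaw ν).prod (iidLaw ν)) :=
  (measurePreserving_splice ν j).integrable_comp_of_integrable hg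

lemma integrable_headMean (hg : Integrable g (iidLaw ν)) (j : ℕ) :
    Integrable (headMean ν g j) (iidLaw ν) :=
  (integrable_splice hg j).integral_prod_left

lemma integral_headMean (hg : Integrable g (iidLaw ν)) (j : ℕ) :
    ∫ x, headMean ν g j x ∂(iidLaw ν) = ∫ x, g x ∂(iidLaw ν) := by
  have h_splice := measurePreserving_splice ν j
  have hg_meas : AEStronglyMeasurable g (Measure.map _ _) :=
    h_splice.map_eq ▸ hg.aestronglyMeasurable
  calc ∫ x, headMean ν g j x ∂(iidLaw ν)
      = ∫ q : (ℕ → 𝕊) × (ℕ → 𝕊), g (splice j q.1 q.2) ∂((iidLaw ν).prod (iidLaw ν)) :=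
        (integral_prod _ (integrable_splice hg j)).symm
    _ = ∫ x, g x ∂(iidLaw ν) := by
        rw [← integral_map h_splice.aemeasurable hg_meas, h_splice.map_eq]

lemma integral_headDiff (hg : Integrable g (iidLaw ν)) (j : ℕ) :
    ∫ x, headDiff ν g j x ∂(iidLaw ν) = 0 := by
  unfold headDiff
  rw [integral_sub (integrable_headMean hg _) (integrable_headMean hg _), integral_headMean hg,
    integral_headMean hg, sub_self]

lemma headDiff_ae_eq (hg_meas : Measurable g) (hg : Integrable g (iidLaw ν)) (j : ℕ) :
    headDiff ν g j =ᵐ[iidLaw ν] fun x => ∫ w : (ℕ → 𝕊) × 𝕊,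
      (g (splice (j + 1) x w.1) - g (Function.update (splice (j + 1) x w.1) j w.2))
        ∂((iidLaw ν).prod ν) := by
  filter_upwards [(integrable_splice hg (j + 1)).prod_right_ae,
    (integrable_splice hg j).prod_right_ae] with x h_int_succ h_int
  have h_update := measurePreserving_update ν j
  have h_meas : Measurable fun z => g (splice j x z) := by fun_prop
  have h_resampled : Integrable
      (fun w : (ℕ → 𝕊) × 𝕊 => g (Function.update (splice (j + 1) x w.1) j w.2))
      ((iidLaw ν).prod ν) := by
    simpa only [Function.comp_def, splice_update] using
      h_update.integrable_comp_of_integrable (g := fun z => g (splice j x z)) h_int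
  rw [integral_sub (h_int_succ.comp_fst ν) h_resampled, headDiff, headMean, headMean]
  congr 1
  · rw [integral_fun_fst fun z => g (splice (j + 1) x z), probReal_univ, one_smul]
  · simp only [← splice_update]
    rw [← integral_map (φ := fun w : (ℕ → 𝕊) × 𝕊 => Function.update w.1 j w.2)
      (f := fun z => g (splice j x z)) h_update.aemeasurable h_meas.aestronglyMeasurable,
      h_update.map_eq]

lemma eLpNorm_headDiff_le {p : ℝ} (hp : 1 ≤ p) (hg_meas : Measurable g)
    (hg : Integrable g (iidLaw ν)) (j : ℕ) :
    eLpNorm (headDiff ν g j) (ENNReal.ofReal p) (iidLaw ν) ≤ dependenceCoeff ν g p j := by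
  have h_meas : Measurable fun w : (ℕ → 𝕊) × 𝕊 => g w.1 - g (Function.update w.1 j w.2) := by
    fun_prop
  have h_splice := measurePreserving_splice_prod ν (j + 1)
  rw [eLpNorm_congr_ae (headDiff_ae_eq hg_meas hg j)]
  exact (eLpNorm_integral_prod_le hp (h_meas.comp h_splice.measurable)).trans_eq
    (eLpNorm_comp_measurePreserving h_meas.aestronglyMeasurable h_splice)

end HeadMean

section CoordinateFiltration

variable {𝕊 : Type*} [MeasurableSpace 𝕊]

lemma iSup_piLE_eq_pi :
    ⨆ n : ℕ, Filtration.piLE (X := fun _ : ℕ => 𝕊) n = MeasurableSpace.pi := by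
  refine le_antisymm (iSup_le fun n => Filtration.le _ n)
    (iSup_le fun i => le_trans ?_ (le_iSup _ i))
  rintro _ ⟨t, ht, rfl⟩
  exact ⟨(fun y : ∀ _ : Set.Iic i, 𝕊 => y ⟨i, Set.mem_Iic.2 le_rfl⟩) ⁻¹' t,
    measurable_pi_apply _ ht, rfl⟩

lemma dependsOn_mem_of_measurableSet_piLE {n : ℕ} {s : Set (ℕ → 𝕊)}
    (hs : MeasurableSet[Filtration.piLE (X := fun _ : ℕ => 𝕊) n] s) :
    DependsOn (· ∈ s) (Set.Iic n) := by
  obtain ⟨t, -, rfl⟩ := hs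
  intro x x' h
  simp only [Set.mem_preimage, Preorder.dependsOn_restrictLe n h]

lemma measurable_piLE_of_dependsOn [Nonempty 𝕊] {β : Type*} [MeasurableSpace β] {n : ℕ}
    {f : (ℕ → 𝕊) → β} (hf : Measurable f) (h_dep : DependsOn f (Set.Iic n)) :
    Measurable[Filtration.piLE (X := fun _ : ℕ => 𝕊) n] f := by
  obtain ⟨a⟩ := ‹Nonempty 𝕊›
  let extend (y : Set.Iic n → 𝕊) (i : ℕ) : 𝕊 := if h : i ≤ n then y ⟨i, h⟩ else a
  have h_extend : Measurable extend := by
    refine measurable_pi_lambda _ fun i => ?_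
    unfold extend
    split_ifs <;> fun_prop
  have h_factor : f = (f ∘ extend) ∘ Preorder.restrictLe n := by
    ext x
    exact h_dep fun i (hi : i ≤ n) => by simp [extend, hi]
  rw [h_factor]
  exact (hf.comp h_extend).comp (comap_measurable _)

variable {ν : Measure 𝕊} [IsProbabilityMeasure ν] {g : (ℕ → 𝕊) → ℝ}

lemma headMean_ae_eq_condExp (hg_meas : Measurable g) (hg : Integrable g (iidLaw ν)) (n : ℕ) :
    headMean ν g (n + 1) =ᵐ[iidLaw ν]
      (iidLaw ν)[g | Filtration.piLE (X := fun _ : ℕ => 𝕊) n] := by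
  have : Nonempty 𝕊 := ν.nonempty_of_neZero
  have h_Iio : Set.Iio (n + 1) = Set.Iic n := by
    ext i
    exact Nat.lt_succ_iff
  refine ae_eq_condExp_of_forall_setIntegral_eq (Filtration.le _ n) hg
    (fun s _ _ => (integrable_headMean hg _).integrableOn) (fun s hs _ => ?_)
    (measurable_piLE_of_dependsOn (measurable_headMean hg_meas _)
      (h_Iio ▸ dependsOn_headMean ν g (n + 1))).aestronglyMeasurable
  have hs_meas : MeasurableSet s := Filtration.le _ n s hs
  rw [← integral_indicator hs_meas, ← integral_indicator hs_meas,
    ← headMean_indicator ν g (h_Iio ▸ dependsOn_mem_of_measurableSet_piLE hs),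
    integral_headMean (hg.indicator hs_meas)]

lemma tendsto_headMean_ae (hg_meas : Measurable g) (hg : Integrable g (iidLaw ν)) :
    ∀ᵐ x ∂(iidLaw ν), Tendsto (fun n => headMean ν g n x) atTop (𝓝 (g x)) := by
  have h_levy := hg.tendsto_ae_condExp (ℱ := Filtration.piLE (X := fun _ : ℕ => 𝕊)) (by
    rw [iSup_piLE_eq_pi]
    exact hg_meas.stronglyMeasurable)
  filter_upwards [h_levy, ae_all_iff.2 fun n => headMean_ae_eq_condExp hg_meas hg n]
    with x hx_tendsto hx_eq
  rw [← tendsto_add_atTop_iff_nat 1]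
  exact hx_tendsto.congr fun n => (hx_eq n).symm

lemma eLpNorm_sub_headMean_le {p : ℝ} (hp : 1 ≤ p) (hg_meas : Measurable g)
    (hg : Integrable g (iidLaw ν)) (J : ℕ) :
    eLpNorm (fun x => g x - headMean ν g J x) (ENNReal.ofReal p) (iidLaw ν) ≤
      ∑' i, dependenceCoeff ν g p (J + i) := by
  have h_meas n : AEStronglyMeasurable
      (fun x => headMean ν g (J + n) x - headMean ν g J x) (iidLaw ν) :=
    ((measurable_headMean hg_meas _).sub (measurable_headMean hg_meas _)).aestronglyMeasurable
  have h_tendsto : ∀ᵐ x ∂(iidLaw ν), Tendsto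
      (fun n => headMean ν g (J + n) x - headMean ν g J x) atTop (𝓝 (g x - headMean ν g J x)) := by
    filter_upwards [tendsto_headMean_ae hg_meas hg] with x hx
    simp only [add_comm J]
    exact ((tendsto_add_atTop_iff_nat J).2 hx).sub_const _
  have h_partial n : eLpNorm (fun x => headMean ν g (J + n) x - headMean ν g J x)
      (ENNReal.ofReal p) (iidLaw ν) ≤ ∑' i, dependenceCoeff ν g p (J + i) := by
    calc _ = eLpNorm (∑ i ∈ Finset.range n, headDiff ν g (J + i))
          (ENNReal.ofReal p) (iidLaw ν) := by
          congr 1 with x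
          rw [Finset.sum_apply, sum_headDiff_add]
      _ ≤ ∑ i ∈ Finset.range n, eLpNorm (headDiff ν g (J + i)) (ENNReal.ofReal p) (iidLaw ν) :=
          eLpNorm_sum_le (fun i _ => (measurable_headDiff hg_meas _).aestronglyMeasurable)
            (by simpa using hp)
      _ ≤ ∑ i ∈ Finset.range n, dependenceCoeff ν g p (J + i) :=
          Finset.sum_le_sum fun i _ => eLpNorm_headDiff_le hp hg_meas hg _
      _ ≤ _ := ENNReal.sum_le_tsum _
  exact (Lp.eLpNorm_lim_le_liminf_eLpNorm h_meas _ h_tendsto).trans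
    (liminf_le_of_frequently_le' (Frequently.of_forall h_partial))

end CoordinateFiltration

lemma measureReal_abs_sum_ge_le_sum {Ω ι : Type*} [MeasurableSpace Ω] {P : Measure Ω}
    [IsFiniteMeasure P] {s : Finset ι} (hs : s.Nonempty) (Y : ι → Ω → ℝ) {u : ι → ℝ} {y : ℝ}
    (hu : ∑ i ∈ s, u i ≤ y) :
    P.real {ω | y ≤ |∑ i ∈ s, Y i ω|} ≤ ∑ i ∈ s, P.real {ω | u i ≤ |Y i ω|} := by
  have h_subset : {ω | y ≤ |∑ i ∈ s, Y i ω|} ⊆ ⋃ i ∈ s, {ω | u i ≤ |Y i ω|} := by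
    intro ω hω
    obtain ⟨i, hi, h_le⟩ := Finset.exists_le_of_sum_le hs
      (hu.trans (hω.trans (Finset.abs_sum_le_sum_abs _ _)))
    exact Set.mem_biUnion hi h_le
  exact (measureReal_mono h_subset (measure_ne_top _ _)).trans (measureReal_biUnion_finset_le _ _)

section ResidueClasses

lemma card_filter_mod_le {l m q : ℕ} (hq : 0 < q) (hqm : q ≤ m) (hlm : l ≤ m) (r : ℕ) :
    (((Finset.range l).filter (· % q = r)).card : ℝ) ≤ 2 * m / q := by
  have h_subset : (Finset.range l).filter (· % q = r) ⊆
      (Finset.range m).filter (· ≡ r [MOD q]) := by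
    intro k hk
    simp only [Finset.mem_filter, Finset.mem_range] at hk ⊢
    exact ⟨hk.1.trans_le hlm, by rw [Nat.ModEq, ← hk.2, Nat.mod_mod]⟩
  have h_count := Finset.card_le_card h_subset
  rw [← Nat.count_eq_card_filter_range (· ≡ r [MOD q]), Nat.count_modEq_card m hq] at h_count
  have h_one_le : 1 ≤ m / q := (Nat.one_le_div_iff hq).2 hqm
  have h_two_mul : ((Finset.range l).filter (· % q = r)).card ≤ 2 * (m / q) := by
    split_ifs at h_count <;> omega
  calc (((Finset.range l).filter (· % q = r)).card : ℝ)
      ≤ 2 * ((m / q : ℕ) : ℝ) := by exact_mod_cast h_two_mul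
    _ ≤ 2 * (m / q) := by
        gcongr
        exact Nat.cast_div_le
    _ = 2 * m / q := by ring

lemma injective_add_sub_of_mod_eq (b : ℤ) {q r : ℕ} {s : Finset ℕ} (hs : ∀ k ∈ s, k % q = r) :
    Function.Injective fun w : s × Fin q => b + ((w.1 : ℕ) : ℤ) - ((w.2 : ℕ) : ℤ) := by
  rintro ⟨⟨k, hk⟩, i⟩ ⟨⟨k', hk'⟩, i'⟩ h
  have h_sum : k + i' = k' + (i : ℕ) := by
    simp only at h
    omega
  have h_mod : (i' : ℕ) ≡ i [MOD q] :=
    Nat.ModEq.add_left_cancel ((hs k hk).trans (hs k' hk').symm) (by rw [h_sum])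
  have h_snd : (i' : ℕ) = i := h_mod.eq_of_lt_of_lt i'.2 i.2
  have h_fst : k = k' := by omega
  simp only [h_fst, Fin.ext h_snd]

end ResidueClasses

lemma iIndepFun_curry {Ω ι κ 𝕊 : Type*} [MeasurableSpace Ω] [MeasurableSpace 𝕊] {P : Measure Ω}
    [IsProbabilityMeasure P] {X : ι × κ → Ω → 𝕊} (hX : ∀ q, Measurable (X q))
    (h_indep : iIndepFun X P) : iIndepFun (fun i ω (k : κ) => X (i, k) ω) P := by
  have h_prob q : IsProbabilityMeasure (P.map (X q)) :=
    Measure.isProbabilityMeasure_map (hX q).aemeasurable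
  have h_row i : P.map (fun ω (k : κ) => X (i, k) ω) =
      Measure.infinitePi fun k => P.map (X (i, k)) :=
    (h_indep.precomp (Prod.mk_right_injective i)).map_fun_eq_infinitePi_map fun k => hX _
  rw [iIndepFun_iff_map_fun_eq_infinitePi_map fun i => by fun_prop]
  simp only [h_row]
  rw [← Measure.infinitePi_map_curry fun i k => P.map (X (i, k)),
    ← h_indep.map_fun_eq_infinitePi_map hX, Measure.map_map (by fun_prop) (by fun_prop)]
  rfl

section CausalSums

variable {Ω 𝕊 : Type*}

/-- The partial sum `∑_{k < l} f (ε_{b+k}, ε_{b+k-1}, …)` of the causal process driven by the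
innovations `ε = e`. -/
noncomputable def causalSum (e : ℤ → Ω → 𝕊) (f : (ℕ → 𝕊) → ℝ) (b : ℤ) (l : ℕ) (ω : Ω) : ℝ :=
  ∑ k ∈ Finset.range l, f (past (e · ω) (b + (k : ℕ)))

variable [MeasurableSpace Ω] [MeasurableSpace 𝕊]

/-- The innovations `e k`, `k ∈ ℤ`, are i.i.d. with law `ν` under `P`. -/
structure IsIID (e : ℤ → Ω → 𝕊) (ν : Measure 𝕊) (P : Measure Ω) : Prop where
  measurable : ∀ k, Measurable (e k)
  indep : iIndepFun e P
  map_eq : ∀ k, P.map (e k) = ν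

variable {P : Measure Ω} {e : ℤ → Ω → 𝕊} {ν : Measure 𝕊}

lemma IsIID.measurePreserving_past (he : IsIID e ν P) (k : ℤ) :
    MeasurePreserving (fun ω => past (e · ω) k) P (iidLaw ν) := by
  refine ⟨measurable_pi_lambda _ fun _ => he.measurable _, ?_⟩
  have h_law := (he.indep.precomp (g := fun j : ℕ => k - j)
    fun i j hij => by simpa using hij).map_fun_eq_infinitePi_map fun j => he.measurable _
  simp only [he.map_eq] at h_law
  exact h_law

variable [IsProbabilityMeasure P]

lemma iIndepFun_comp_past (he : ∀ k, Measurable (e k)) (h_indep : iIndepFun e P) {q r : ℕ}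
    {f : (ℕ → 𝕊) → ℝ} (hf : Measurable f) (h_dep : DependsOn f (Set.Iio q)) (b : ℤ)
    {s : Finset ℕ} (hs : ∀ k ∈ s, k % q = r) :
    iIndepFun (fun (k : s) ω => f (past (e · ω) (b + (k : ℕ)))) P := by
  obtain ⟨ω₀⟩ : Nonempty Ω := P.nonempty_of_neZero
  let extend (y : Fin q → 𝕊) (i : ℕ) : 𝕊 := if h : i < q then y ⟨i, h⟩ else e 0 ω₀
  have h_extend : Measurable extend := by
    refine measurable_pi_lambda _ fun i => ?_
    unfold extend
    split_ifs <;> fun_prop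
  have h_blocks := iIndepFun_curry (fun _ => he _)
    (h_indep.precomp (injective_add_sub_of_mod_eq b hs))
  convert! h_blocks.comp (fun _ => f ∘ extend) fun _ => hf.comp h_extend using 3
  exact h_dep fun i (hi : i < q) => by simp [past, extend, hi]

variable {p s u : ℝ} {l m q : ℕ} {f : (ℕ → 𝕊) → ℝ}

lemma IsIID.measureReal_abs_sum_residueClass_ge_le (he : IsIID e ν P) (hp : 2 ≤ p) (hs₀ : 0 < s)
    (hu : 0 < u) (hq : 0 < q) (hqm : q ≤ m) (hlm : l ≤ m) (hf : Measurable f)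
    (h_dep : DependsOn f (Set.Iio q)) (hf₀ : ∫ x, f x ∂(iidLaw ν) = 0)
    (hs : eLpNorm f (ENNReal.ofReal p) (iidLaw ν) ≤ ENNReal.ofReal s) (b : ℤ) (r : ℕ) :
    P.real {ω | u ≤ |∑ k ∈ (Finset.range l).filter (· % q = r),
        f (past (e · ω) (b + (k : ℕ)))|} ≤
      2 * fukNagaevConst p * ((2 * m / q) * s ^ p / u ^ p +
        Real.exp (-(u ^ 2 / (4 * ((2 * m / q) * s ^ 2))))) := by
  have h_past (k : ℕ) := he.measurePreserving_past (b + k)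
  have hm : 0 < m := hq.trans_le hqm
  simp only [← Finset.sum_coe_sort ((Finset.range l).filter (· % q = r))]
  refine measureReal_abs_sum_ge_le_fukNagaev hp hs₀ (by positivity) hu ?_
    (fun k => hf.comp (h_past k).measurable)
    (iIndepFun_comp_past he.measurable he.indep hf h_dep b fun k hk => (Finset.mem_filter.1 hk).2)
    (fun k => ?_) (fun k => ?_)
  · rw [Fintype.card_coe]
    exact card_filter_mod_le hq hqm hlm r
  · rw [← hf₀, ← (h_past k).map_eq, integral_map (h_past k).aemeasurable hf.aestronglyMeasurable]
  · exact (eLpNorm_comp_measurePreserving hf.aestronglyMeasurable (h_past k)).trans_le hs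

lemma IsIID.measureReal_abs_causalSum_ge_le_of_dependsOn (he : IsIID e ν P) (hp : 2 ≤ p)
    (hs₀ : 0 < s) (hu : 0 < u) (hq : 0 < q) (hqm : q ≤ m) (hlm : l ≤ m) (hf : Measurable f)
    (h_dep : DependsOn f (Set.Iio q)) (hf₀ : ∫ x, f x ∂(iidLaw ν) = 0)
    (hs : eLpNorm f (ENNReal.ofReal p) (iidLaw ν) ≤ ENNReal.ofReal s) (b : ℤ) :
    P.real {ω | u ≤ |causalSum e f b l ω|} ≤
      q * (2 * fukNagaevConst p * ((2 * m / q) * s ^ p / (u / q) ^ p +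
        Real.exp (-((u / q) ^ 2 / (4 * ((2 * m / q) * s ^ 2)))))) := by
  have hq' : (0 : ℝ) < q := by exact_mod_cast hq
  have h_classes ω : causalSum e f b l ω = ∑ r ∈ Finset.range q,
      ∑ k ∈ (Finset.range l).filter (· % q = r), f (past (e · ω) (b + (k : ℕ))) :=
    (Finset.sum_fiberwise_of_maps_to
      (fun k _ => Finset.mem_range.2 (Nat.mod_lt k hq)) _).symm
  have h_level : ∑ _r ∈ Finset.range q, u / q ≤ u := by
    rw [Finset.sum_const, Finset.card_range, nsmul_eq_mul, mul_div_cancel₀ u hq'.ne']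
  simp only [h_classes]
  refine (measureReal_abs_sum_ge_le_sum (Finset.nonempty_range_iff.2 hq.ne') _ h_level).trans ?_
  refine (Finset.sum_le_sum fun r _ => he.measureReal_abs_sum_residueClass_ge_le hp hs₀
    (div_pos hu hq') hq hqm hlm hf h_dep hf₀ hs b r).trans_eq ?_
  rw [Finset.sum_const, Finset.card_range, nsmul_eq_mul]

end CausalSums

section PowSeries

/-- The series `∑_{j ≥ 1} j ^ r`, with the junk value `0` when it diverges. -/
noncomputable def powSeries (r : ℝ) : ℝ := ∑' j : ℕ, ((j : ℝ) + 1) ^ r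

variable {r a : ℝ}

lemma summable_natCast_add_one_rpow (hr : r < -1) : Summable fun j : ℕ => ((j : ℝ) + 1) ^ r := by
  simpa using (summable_nat_add_iff 1).2 (Real.summable_nat_rpow.2 hr)

lemma sum_range_le_powSeries (hr : r < -1) (n : ℕ) :
    ∑ j ∈ Finset.range n, ((j : ℝ) + 1) ^ r ≤ powSeries r :=
  (summable_natCast_add_one_rpow hr).sum_le_tsum _ fun j _ => by positivity

lemma powSeries_pos (hr : r < -1) : 0 < powSeries r :=
  one_pos.trans_le (by simpa using sum_range_le_powSeries hr 1)

lemma max_one_rpow_neg_le (ha : 0 ≤ a) (j : ℕ) :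
    (max (j : ℝ) 1) ^ (-a) ≤ 2 ^ a * ((j : ℝ) + 1) ^ (-a) := by
  have h_le : ((j : ℝ) + 1) / 2 ≤ max (j : ℝ) 1 := by
    linarith [le_max_left (j : ℝ) 1, le_max_right (j : ℝ) 1]
  calc (max (j : ℝ) 1) ^ (-a) ≤ (((j : ℝ) + 1) / 2) ^ (-a) :=
        Real.rpow_le_rpow_of_nonpos (by positivity) h_le (by linarith)
    _ = 2 ^ a * ((j : ℝ) + 1) ^ (-a) := by
        rw [Real.div_rpow (by positivity) zero_le_two, Real.rpow_neg zero_le_two, div_inv_eq_mul,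
          mul_comm]

lemma mul_rpow_neg_le (ha : 1 ≤ a) (m i : ℕ) :
    (m : ℝ) * ((m + i : ℕ) + 1 : ℝ) ^ (-a) ≤ ((i : ℝ) + 1) ^ (1 - a) := by
  have h_m : (m : ℝ) ≤ (m + i : ℕ) + 1 := by
    push_cast
    linarith [(Nat.cast_nonneg i : (0 : ℝ) ≤ i)]
  have h_i : (i : ℝ) + 1 ≤ (m + i : ℕ) + 1 := by
    push_cast
    linarith [(Nat.cast_nonneg m : (0 : ℝ) ≤ m)]
  calc (m : ℝ) * ((m + i : ℕ) + 1 : ℝ) ^ (-a)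
      ≤ ((m + i : ℕ) + 1 : ℝ) * ((m + i : ℕ) + 1 : ℝ) ^ (-a) := by gcongr
    _ = ((m + i : ℕ) + 1 : ℝ) ^ (1 - a) := by
        rw [sub_eq_add_neg, Real.rpow_add (by positivity), Real.rpow_one]
    _ ≤ ((i : ℝ) + 1) ^ (1 - a) :=
        Real.rpow_le_rpow_of_nonpos (by positivity) h_i (by linarith)

end PowSeries

section LevelBounds

variable {p a η B y m q : ℝ}

lemma mul_rpow_neg_div_self (hq : 0 < q) :
    y * q ^ (-(1 + η)) / q = y * q ^ (-(2 + η)) := by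
  rw [mul_div_assoc, ← Real.rpow_sub_one hq.ne']
  ring_nf

lemma level_power_term_eq (hB : 0 < B) (hy : 0 < y) (hq : 0 < q) :
    q * ((2 * m / q) * (B * q ^ (-a)) ^ p / (y * q ^ (-(1 + η)) / q) ^ p) =
      2 * B ^ p * (m / y ^ p) * q ^ (-(p * (a - 2 - η))) := by
  have h_exponent : q ^ (-(p * (a - 2 - η))) = q ^ (-a * p) / q ^ (-(2 + η) * p) := by
    rw [← Real.rpow_sub hq]
    ring_nf
  rw [mul_rpow_neg_div_self hq, Real.mul_rpow hB.le (by positivity),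
    Real.mul_rpow hy.le (by positivity), ← Real.rpow_mul hq.le, ← Real.rpow_mul hq.le, h_exponent]
  field_simp

lemma le_level_exponent (ha : 3 / 2 + η ≤ a) (hB : 0 < B) (hm : 0 < m) (hq : 1 ≤ q) :
    y ^ 2 / (8 * B ^ 2 * m) ≤
      (y * q ^ (-(1 + η)) / q) ^ 2 / (4 * ((2 * m / q) * (B * q ^ (-a)) ^ 2)) := by
  have hq₀ : 0 < q := by linarith
  have h_exponent : 2 * a - 3 - 2 * η = 1 + -(2 + η) * (2 : ℕ) - -a * (2 : ℕ) := by
    push_cast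
    ring
  have h_power : q * (q ^ (-(2 + η))) ^ 2 / (q ^ (-a)) ^ 2 = q ^ (2 * a - 3 - 2 * η) := by
    rw [h_exponent, Real.rpow_sub hq₀, Real.rpow_add hq₀, Real.rpow_one,
      Real.rpow_mul_natCast hq₀.le, Real.rpow_mul_natCast hq₀.le]
  calc y ^ 2 / (8 * B ^ 2 * m)
      ≤ y ^ 2 / (8 * B ^ 2 * m) * q ^ (2 * a - 3 - 2 * η) :=
        le_mul_of_one_le_right (by positivity) (Real.one_le_rpow hq (by linarith))
    _ = _ := by
        rw [mul_rpow_neg_div_self hq₀, ← h_power]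
        field_simp
        ring

end LevelBounds

section CausalFukNagaev

variable {Ω 𝕊 : Type*} [MeasurableSpace Ω] [MeasurableSpace 𝕊] {P : Measure Ω}
  {e : ℤ → Ω → 𝕊} {ν : Measure 𝕊} {p a η B y : ℝ} {l m : ℕ} {f g : (ℕ → 𝕊) → ℝ}

lemma IsIID.eLpNorm_causalSum_le (he : IsIID e ν P) (hp : 1 ≤ p) (hf : Measurable f) (b : ℤ)
    (l : ℕ) :
    eLpNorm (causalSum e f b l) (ENNReal.ofReal p) P ≤
      l * eLpNorm f (ENNReal.ofReal p) (iidLaw ν) := by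
  have h_past (k : ℕ) := he.measurePreserving_past (b + k)
  have h_sum : causalSum e f b l =
      ∑ k ∈ Finset.range l, fun ω => f (past (e · ω) (b + (k : ℕ))) := by
    ext ω
    simp only [causalSum, Finset.sum_apply]
  calc eLpNorm (causalSum e f b l) (ENNReal.ofReal p) P
      ≤ ∑ k ∈ Finset.range l,
          eLpNorm (fun ω => f (past (e · ω) (b + (k : ℕ)))) (ENNReal.ofReal p) P :=
        h_sum ▸ eLpNorm_sum_le
          (fun k _ => (hf.comp (h_past k).measurable).aestronglyMeasurable) (by simpa using hp)
    _ = ∑ _k ∈ Finset.range l, eLpNorm f (ENNReal.ofReal p) (iidLaw ν) :=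
        Finset.sum_congr rfl fun k _ =>
          eLpNorm_comp_measurePreserving hf.aestronglyMeasurable (h_past k)
    _ = l * eLpNorm f (ENNReal.ofReal p) (iidLaw ν) := by
        rw [Finset.sum_const, Finset.card_range, nsmul_eq_mul]

lemma natCast_mul_tsum_dependenceCoeff_le (ha : 2 < a) (hB : 0 ≤ B)
    (h_decay : ∀ j, dependenceCoeff ν g p j ≤ ENNReal.ofReal (B * ((j : ℝ) + 1) ^ (-a))) (m : ℕ) :
    m * ∑' i, dependenceCoeff ν g p (m + i) ≤ ENNReal.ofReal (B * powSeries (1 - a)) := by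
  have h_term i : m * dependenceCoeff ν g p (m + i) ≤
      ENNReal.ofReal (B * ((i : ℝ) + 1) ^ (1 - a)) := by
    calc m * dependenceCoeff ν g p (m + i)
        ≤ m * ENNReal.ofReal (B * ((m + i : ℕ) + 1 : ℝ) ^ (-a)) := by
          gcongr
          exact h_decay _
      _ = ENNReal.ofReal (B * (m * ((m + i : ℕ) + 1 : ℝ) ^ (-a))) := by
          rw [← ENNReal.ofReal_natCast, ← ENNReal.ofReal_mul (Nat.cast_nonneg m), mul_left_comm]
      _ ≤ _ := by
          gcongr
          exact mul_rpow_neg_le (by linarith) m i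
  rw [← ENNReal.tsum_mul_left, powSeries, ← tsum_mul_left, ENNReal.ofReal_tsum_of_nonneg
    (fun i => by positivity) ((summable_natCast_add_one_rpow (by linarith)).mul_left _)]
  exact ENNReal.tsum_le_tsum h_term

variable [IsProbabilityMeasure P] [IsProbabilityMeasure ν]

lemma IsIID.measureReal_abs_causalSum_sub_headMean_ge_le (he : IsIID e ν P) (hp : 1 ≤ p)
    (ha : 2 < a) (hB : 0 ≤ B) (hg_meas : Measurable g) (hg : Integrable g (iidLaw ν))
    (h_decay : ∀ j, dependenceCoeff ν g p j ≤ ENNReal.ofReal (B * ((j : ℝ) + 1) ^ (-a)))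
    (hm : 1 ≤ m) (hlm : l ≤ m) (hy : 0 < y) (b : ℤ) :
    P.real {ω | y ≤ |causalSum e (fun x => g x - headMean ν g m x) b l ω|} ≤
      (B * powSeries (1 - a)) ^ p * (m / y ^ p) := by
  have h_meas : Measurable fun x => g x - headMean ν g m x :=
    hg_meas.sub (measurable_headMean hg_meas m)
  have h_series : 0 < powSeries (1 - a) := powSeries_pos (by linarith)
  have h_sum_meas : AEStronglyMeasurable
      (causalSum e (fun x => g x - headMean ν g m x) b l) P :=
    Finset.aestronglyMeasurable_fun_sum _ fun k _ =>
      (h_meas.comp (he.measurePreserving_past (b + k)).measurable).aestronglyMeasurable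
  have h_norm : eLpNorm (causalSum e (fun x => g x - headMean ν g m x) b l)
      (ENNReal.ofReal p) P ≤ ENNReal.ofReal (B * powSeries (1 - a)) := by
    calc _ ≤ l * eLpNorm (fun x => g x - headMean ν g m x) (ENNReal.ofReal p) (iidLaw ν) :=
          he.eLpNorm_causalSum_le hp h_meas b l
      _ ≤ m * ∑' i, dependenceCoeff ν g p (m + i) := by
          gcongr
          exact eLpNorm_sub_headMean_le hp hg_meas hg m
      _ ≤ _ := natCast_mul_tsum_dependenceCoeff_le ha hB h_decay m
  calc _ ≤ (B * powSeries (1 - a)) ^ p / y ^ p :=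
        measureReal_abs_ge_le_of_eLpNorm_le (by linarith) (by positivity) hy h_sum_meas h_norm
    _ = (B * powSeries (1 - a)) ^ p * (1 / y ^ p) := by ring
    _ ≤ (B * powSeries (1 - a)) ^ p * (m / y ^ p) := by
        gcongr
        exact_mod_cast hm

lemma IsIID.measureReal_abs_causalSum_headDiff_ge_le (he : IsIID e ν P) (hp : 2 ≤ p)
    (ha : 3 / 2 + η ≤ a) (hB : 0 < B) (hg_meas : Measurable g) (hg : Integrable g (iidLaw ν))
    {j : ℕ} (h_decay : dependenceCoeff ν g p j ≤ ENNReal.ofReal (B * ((j : ℝ) + 1) ^ (-a)))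
    (hj : j < m) (hlm : l ≤ m) (hy : 0 < y) (b : ℤ) :
    P.real {ω | y * ((j : ℝ) + 1) ^ (-(1 + η)) ≤ |causalSum e (headDiff ν g j) b l ω|} ≤
      2 * fukNagaevConst p * (2 * B ^ p * (m / y ^ p) * ((j : ℝ) + 1) ^ (-(p * (a - 2 - η))) +
        m * Real.exp (-(y ^ 2 / (8 * B ^ 2 * m)))) := by
  have hm : (0 : ℝ) < m := by exact_mod_cast j.zero_le.trans_lt hj
  have hj₀ : (0 : ℝ) < (j : ℝ) + 1 := by positivity
  have hj₁ : (1 : ℝ) ≤ (j : ℝ) + 1 := by linarith [(Nat.cast_nonneg j : (0 : ℝ) ≤ j)]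
  have hjm : (j : ℝ) + 1 ≤ m := by exact_mod_cast hj
  have h_const := one_le_fukNagaevConst (p := p) (by linarith)
  have h_block := he.measureReal_abs_causalSum_ge_le_of_dependsOn hp (by positivity)
    (by positivity : 0 < y * ((j : ℝ) + 1) ^ (-(1 + η))) j.succ_pos hj hlm
    (measurable_headDiff hg_meas j) (dependsOn_headDiff ν g j) (integral_headDiff hg j)
    ((eLpNorm_headDiff_le (by linarith) hg_meas hg j).trans h_decay) b
  push_cast at h_block
  refine h_block.trans ?_
  rw [mul_left_comm, mul_add, level_power_term_eq hB hy hj₀]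
  gcongr _ * (_ + ?_ * Real.exp (-?_))
  exact le_level_exponent ha hB hm hj₁

lemma IsIID.measureReal_abs_causalSum_headMean_ge_le (he : IsIID e ν P) (hp : 2 ≤ p)
    (hη : 0 < η) (ha : 3 / 2 + η ≤ a) (ha' : 1 < p * (a - 2 - η)) (hB : 0 < B)
    (hg_meas : Measurable g) (hg : Integrable g (iidLaw ν)) (hg₀ : ∫ x, g x ∂(iidLaw ν) = 0)
    (h_decay : ∀ j, dependenceCoeff ν g p j ≤ ENNReal.ofReal (B * ((j : ℝ) + 1) ^ (-a)))
    (hm : 1 ≤ m) (hlm : l ≤ m) (hy : 0 < y) (b : ℤ) :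
    P.real {ω | y * powSeries (-(1 + η)) ≤ |causalSum e (headMean ν g m) b l ω|} ≤
      2 * fukNagaevConst p * (2 * B ^ p * (m / y ^ p) * powSeries (-(p * (a - 2 - η))) +
        m ^ 2 * Real.exp (-(y ^ 2 / (8 * B ^ 2 * m)))) := by
  have h_const := one_le_fukNagaevConst (p := p) (by linarith)
  have h_levels ω : causalSum e (headMean ν g m) b l ω =
      ∑ j ∈ Finset.range m, causalSum e (headDiff ν g j) b l ω := by
    simp only [causalSum, ← sum_headDiff hg₀]
    exact Finset.sum_comm
  have h_weights : ∑ j ∈ Finset.range m, y * ((j : ℝ) + 1) ^ (-(1 + η)) ≤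
      y * powSeries (-(1 + η)) := by
    rw [← Finset.mul_sum]
    gcongr
    exact sum_range_le_powSeries (by linarith) m
  simp only [h_levels]
  calc _ ≤ ∑ j ∈ Finset.range m, P.real {ω | y * ((j : ℝ) + 1) ^ (-(1 + η)) ≤
          |causalSum e (headDiff ν g j) b l ω|} :=
        measureReal_abs_sum_ge_le_sum (Finset.nonempty_range_iff.2 (by omega)) _ h_weights
    _ ≤ ∑ j ∈ Finset.range m, 2 * fukNagaevConst p *
          (2 * B ^ p * (m / y ^ p) * ((j : ℝ) + 1) ^ (-(p * (a - 2 - η))) +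
            m * Real.exp (-(y ^ 2 / (8 * B ^ 2 * m)))) :=
        Finset.sum_le_sum fun j hj => he.measureReal_abs_causalSum_headDiff_ge_le hp ha hB
          hg_meas hg (h_decay j) (Finset.mem_range.1 hj) hlm hy b
    _ = 2 * fukNagaevConst p * (2 * B ^ p * (m / y ^ p) *
          ∑ j ∈ Finset.range m, ((j : ℝ) + 1) ^ (-(p * (a - 2 - η))) +
            m ^ 2 * Real.exp (-(y ^ 2 / (8 * B ^ 2 * m)))) := by
        rw [← Finset.mul_sum, Finset.sum_add_distrib, ← Finset.mul_sum, Finset.sum_const,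
          Finset.card_range, nsmul_eq_mul]
        ring
    _ ≤ _ := by
        gcongr
        exact sum_range_le_powSeries (by linarith) m

end CausalFukNagaev

section CausalFukNagaevInequality

lemma measureReal_abs_add_ge_le {Ω : Type*} [MeasurableSpace Ω] {P : Measure Ω}
    [IsFiniteMeasure P] (X Y : Ω → ℝ) {u v y : ℝ} (h : u + v ≤ y) :
    P.real {ω | y ≤ |X ω + Y ω|} ≤ P.real {ω | u ≤ |X ω|} + P.real {ω | v ≤ |Y ω|} := by
  simpa [Fin.sum_univ_two] using measureReal_abs_sum_ge_le_sum (P := P) Finset.univ_nonempty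
    ![X, Y] (u := ![u, v]) (y := y) (by simpa [Fin.sum_univ_two] using h)

lemma rpow_mul_div_div_rpow {B Z m p y : ℝ} (hB : 0 ≤ B) (hZ : 0 ≤ Z) (hy : 0 ≤ y) :
    B ^ p * (m / (y / Z) ^ p) = (B * Z) ^ p * (m / y ^ p) := by
  rw [Real.div_rpow hy hZ, Real.mul_rpow hB hZ, div_div_eq_mul_div]
  ring

lemma IsIID.measureReal_abs_causalSum_ge_le {Ω 𝕊 : Type*} [MeasurableSpace Ω]
    [MeasurableSpace 𝕊] {P : Measure Ω} [IsProbabilityMeasure P] {ν : Measure 𝕊}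
    [IsProbabilityMeasure ν] {e : ℤ → Ω → 𝕊} {g : (ℕ → 𝕊) → ℝ} {p a η B y : ℝ} {l m : ℕ}
    (he : IsIID e ν P) (hp : 2 ≤ p) (hη : 0 < η) (ha : 3 / 2 + η ≤ a)
    (ha' : 1 < p * (a - 2 - η)) (hB : 0 < B) (hg_meas : Measurable g)
    (hg : Integrable g (iidLaw ν)) (hg₀ : ∫ x, g x ∂(iidLaw ν) = 0)
    (h_decay : ∀ j, dependenceCoeff ν g p j ≤ ENNReal.ofReal (B * ((j : ℝ) + 1) ^ (-a)))
    (hm : 1 ≤ m) (hlm : l ≤ m) (hy : 0 < y) (b : ℤ) :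
    P.real {ω | y ≤ |causalSum e g b l ω|} ≤
      (4 * fukNagaevConst p * (B * (2 * powSeries (-(1 + η)))) ^ p *
        powSeries (-(p * (a - 2 - η))) + (B * powSeries (1 - a) * 2) ^ p) * (m / y ^ p) +
      2 * fukNagaevConst p * m ^ 2 *
        Real.exp (-(1 / (8 * (B * (2 * powSeries (-(1 + η)))) ^ 2) * y ^ 2 / m)) := by
  have ha₂ : 2 < a := by
    have h_pos : 0 < a - 2 - η :=
      pos_of_mul_pos_right (one_pos.trans ha') (zero_le_two.trans hp)
    linarith
  have h_weights : 0 < powSeries (-(1 + η)) := powSeries_pos (by linarith)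
  have h_tail : 0 < powSeries (1 - a) := powSeries_pos (by linarith)
  have h_split ω : causalSum e g b l ω = causalSum e (headMean ν g m) b l ω +
      causalSum e (fun x => g x - headMean ν g m x) b l ω := by
    simp only [causalSum, ← Finset.sum_add_distrib, add_sub_cancel]
  have h_half : y / (2 * powSeries (-(1 + η))) * powSeries (-(1 + η)) + y / 2 ≤ y := by
    field_simp
    norm_num
  have h_exponent : (y / (2 * powSeries (-(1 + η)))) ^ 2 / (8 * B ^ 2 * m) =
      1 / (8 * (B * (2 * powSeries (-(1 + η)))) ^ 2) * y ^ 2 / m := by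
    field_simp
  have h_head := he.measureReal_abs_causalSum_headMean_ge_le hp hη ha ha' hB hg_meas hg hg₀
    h_decay hm hlm (by positivity : 0 < y / (2 * powSeries (-(1 + η)))) b
  have h_rest := he.measureReal_abs_causalSum_sub_headMean_ge_le (by linarith) ha₂ hB.le hg_meas
    hg h_decay hm hlm (half_pos hy) b
  rw [mul_assoc 2 (B ^ p), rpow_mul_div_div_rpow hB.le (by positivity) hy.le, h_exponent] at h_head
  rw [rpow_mul_div_div_rpow (by positivity) zero_le_two hy.le] at h_rest
  simp only [h_split]
  exact (measureReal_abs_add_ge_le _ _ h_half).trans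
    ((add_le_add h_head h_rest).trans_eq (by ring))

theorem exists_fukNagaev_causalSum {p a A : ℝ} (hp : 2 ≤ p) (ha : 2 + 1 / p < a) (hA : 0 < A) :
    ∃ C c : ℝ, 0 < C ∧ 0 < c ∧ ∀ {Ω 𝕊 : Type*} [MeasurableSpace Ω] [MeasurableSpace 𝕊]
      {P : Measure Ω} [IsProbabilityMeasure P] {ν : Measure 𝕊} [IsProbabilityMeasure ν]
      {e : ℤ → Ω → 𝕊} {g : (ℕ → 𝕊) → ℝ}, IsIID e ν P → Measurable g →
      Integrable g (iidLaw ν) → ∫ x, g x ∂(iidLaw ν) = 0 →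
      (∀ j : ℕ, dependenceCoeff ν g p j ≤ ENNReal.ofReal (A * (max (j : ℝ) 1) ^ (-a))) →
      ∀ (b : ℤ) (l m : ℕ), 1 ≤ m → l ≤ m → ∀ y : ℝ, 0 < y →
        P.real {ω | y ≤ |causalSum e g b l ω|} ≤
          C * (m / y ^ p) + C * m ^ 2 * Real.exp (-(c * y ^ 2 / m)) := by
  have hp₀ : 0 < p := by linarith
  have hpa : 1 < p * (a - 2) := by
    rwa [← div_lt_iff₀' hp₀, lt_sub_iff_add_lt']
  have ha₂ : 2 < a := by linarith [one_div_pos.2 hp₀]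
  obtain ⟨η, hη₀, hηa, hη⟩ : ∃ η > 0, η ≤ a - 2 ∧ p * (a - 2 - η) = (p * (a - 2) + 1) / 2 :=
    ⟨(a - 2 - 1 / p) / 2, by linarith, by linarith [one_div_pos.2 hp₀], by field_simp; ring⟩
  have ha' : 1 < p * (a - 2 - η) := by linarith
  have h_weights := powSeries_pos (r := -(1 + η)) (by linarith)
  have h_levels := powSeries_pos (r := -(p * (a - 2 - η))) (by linarith)
  have h_tail := powSeries_pos (r := 1 - a) (by linarith)
  have h_const := one_le_fukNagaevConst hp₀.le
  obtain ⟨B, hB, hAB⟩ : ∃ B > 0, ∀ j : ℕ,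
      A * (max (j : ℝ) 1) ^ (-a) ≤ B * ((j : ℝ) + 1) ^ (-a) := by
    refine ⟨A * 2 ^ a, by positivity, fun j => ?_⟩
    rw [mul_assoc]
    gcongr
    exact max_one_rpow_neg_le (by linarith) j
  refine ⟨4 * fukNagaevConst p * (B * (2 * powSeries (-(1 + η)))) ^ p *
        powSeries (-(p * (a - 2 - η))) + (B * powSeries (1 - a) * 2) ^ p + 2 * fukNagaevConst p,
    1 / (8 * (B * (2 * powSeries (-(1 + η)))) ^ 2), by positivity, by positivity, ?_⟩
  intro Ω 𝕊 _ _ P _ ν _ e g he hg_meas hg hg₀ h_decay b l m hm hlm y hy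
  refine (he.measureReal_abs_causalSum_ge_le hp hη₀ (by linarith) ha' hB hg_meas hg hg₀
    (fun j => (h_decay j).trans (ENNReal.ofReal_le_ofReal (hAB j))) hm hlm hy b).trans ?_
  gcongr ?_ * _ + ?_ * _ * _
  · exact le_add_of_nonneg_right (by positivity)
  · exact le_add_of_nonneg_left (by positivity)

end CausalFukNagaevInequality

/-- The process `S` satisfies a Fuk–Nagaev inequality for its increments over at most `m` time
steps: a polynomial tail of order `p` and a Gaussian tail, uniformly in the position. -/
def HasFukNagaevIncrements {Ω : Type*} [MeasurableSpace Ω] (P : Measure Ω) (S : ℕ → Ω → ℝ)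
    (p C c : ℝ) : Prop :=
  ∀ i k m : ℕ, 1 ≤ m → k ≤ i + m → i ≤ k + m → ∀ y : ℝ, 0 < y →
    P.real {ω | y ≤ |S k ω - S i ω|} ≤
      C * (m / y ^ p) + C * m ^ 2 * Real.exp (-(c * y ^ 2 / m))

lemma le_supStar_const {α : Type*} [CompleteLattice α] (c : ℕ → α) (h : ℕ) :
    c h ≤ supStar fun _ h => c h := by
  refine le_limsup_of_frequently_le' (Eventually.frequently ?_)
  filter_upwards [eventually_gt_atTop h] with d hd
  exact le_iSup (fun i : Fin d => c i) ⟨h, hd⟩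

namespace ChangePointModel

section NoiseSum

variable {Ω 𝕊 : Type*}

/-- The partial sums `∑_{1 ≤ j ≤ k} U_{j,h}` of the noise in coordinate `h`. -/
noncomputable def noiseSum (M : ChangePointModel Ω 𝕊) (h k : ℕ) (ω : Ω) : ℝ :=
  ∑ j ∈ Finset.Icc 1 k, M.noise j h ω

lemma noiseSum_zero (M : ChangePointModel Ω 𝕊) (h : ℕ) (ω : Ω) : M.noiseSum h 0 ω = 0 := by
  simp [noiseSum]

lemma noiseSum_add (M : ChangePointModel Ω 𝕊) (h i l : ℕ) (ω : Ω) :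
    M.noiseSum h (i + l) ω =
      M.noiseSum h i ω + causalSum M.innov (M.g h) ((i : ℤ) + 1) l ω := by
  induction l with
  | zero => simp [causalSum]
  | succ l ih =>
    rw [noiseSum, ← add_assoc, Finset.sum_Icc_succ_top (by omega), ← noiseSum, ih, causalSum,
      causalSum, Finset.sum_range_succ, add_assoc]
    push_cast
    rw [add_right_comm (i : ℤ) l 1]
    rfl

variable [MeasurableSpace Ω] [MeasurableSpace 𝕊] {P : Measure Ω} {M : ChangePointModel Ω 𝕊}

lemma IsRegular.isIID (hM : M.IsRegular P) : IsIID M.innov (P.map (M.innov 0)) P where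
  measurable := hM.measurable_innov
  indep := hM.indep
  map_eq k := (hM.identDistrib k).map_eq

lemma IsRegular.integrable_g (hM : M.IsRegular P) (h : ℕ) :
    Integrable (M.g h) (iidLaw (P.map (M.innov 0))) :=
  ((hM.isIID.measurePreserving_past 0).integrable_comp
    (hM.measurable_g h).aestronglyMeasurable).1 (hM.integrable 0 h)

lemma IsRegular.integral_g (hM : M.IsRegular P) (h : ℕ) :
    ∫ x, M.g h x ∂(iidLaw (P.map (M.innov 0))) = 0 := by
  have h_past := hM.isIID.measurePreserving_past 0
  rw [← h_past.map_eq, integral_map h_past.aemeasurable (hM.measurable_g h).aestronglyMeasurable]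
  exact hM.centered 0 h

variable [IsProbabilityMeasure P]

lemma IsRegular.dependenceCoeff_le_depMeasure (hM : M.IsRegular P) (p : ℝ) (h k : ℕ) :
    dependenceCoeff (P.map (M.innov 0)) (M.g h) p k ≤ M.depMeasure P p k := by
  have : IsProbabilityMeasure (P.map (M.innov 0)) :=
    Measure.isProbabilityMeasure_map (hM.measurable_innov 0).aemeasurable
  have h_pair := (hM.isIID.measurePreserving_past k).prod
    ((hM.measurable_innov 0).measurePreserving P)
  have hg := hM.measurable_g h
  have h_past (w : Ω × Ω) : Function.update (past (fun i => M.innov i w.1) k) k (M.innov 0 w.2) =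
      past (fun i => if i = 0 then M.innov 0 w.2 else M.innov i w.1) k := by
    ext j
    have hj : (k : ℤ) - j = 0 ↔ j = k := by omega
    simp only [past, Function.update_apply, hj]
  rw [dependenceCoeff,
    ← eLpNorm_comp_measurePreserving (Measurable.aestronglyMeasurable (by fun_prop)) h_pair]
  refine le_trans (le_of_eq ?_) (le_supStar_const _ h)
  simp only [Function.comp_def, Prod.map_fst, Prod.map_snd, h_past]

end NoiseSum

theorem exists_hasFukNagaevIncrements_noiseSum {p a A : ℝ} (hp : 2 ≤ p) (ha : 2 + 1 / p < a)
    (hA : 0 < A) :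
    ∃ C c : ℝ, 0 < C ∧ 0 < c ∧ ∀ {Ω 𝕊 : Type*} [MeasurableSpace Ω] [MeasurableSpace 𝕊]
      {P : Measure Ω} [IsProbabilityMeasure P] {M : ChangePointModel Ω 𝕊}, M.IsRegular P →
      (∀ k : ℕ, M.depMeasure P p k ≤ ENNReal.ofReal (A * (max (k : ℝ) 1) ^ (-a))) →
      ∀ h, HasFukNagaevIncrements P (M.noiseSum h) p C c := by
  obtain ⟨C, c, hC, hc, h_causal⟩ := exists_fukNagaev_causalSum hp ha hA
  refine ⟨C, c, hC, hc, fun {Ω 𝕊 _ _ P _ M} hM h_decay h i k m hm hki hik y hy => ?_⟩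
  have : IsProbabilityMeasure (P.map (M.innov 0)) :=
    Measure.isProbabilityMeasure_map (hM.measurable_innov 0).aemeasurable
  have h_forward (i l : ℕ) (hl : l ≤ m) :
      P.real {ω | y ≤ |M.noiseSum h (i + l) ω - M.noiseSum h i ω|} ≤
        C * (m / y ^ p) + C * m ^ 2 * Real.exp (-(c * y ^ 2 / m)) := by
    simp only [noiseSum_add, add_sub_cancel_left]
    exact h_causal hM.isIID (hM.measurable_g h) (hM.integrable_g h) (hM.integral_g h)
      (fun j => (hM.dependenceCoeff_le_depMeasure p h j).trans (h_decay j)) _ l m hm hl y hy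
  rcases le_total i k with h_le | h_le <;> obtain ⟨l, rfl⟩ := Nat.exists_eq_add_of_le h_le
  · exact h_forward i l (by omega)
  · simpa only [abs_sub_comm] using h_forward k l (by omega)

end ChangePointModel

section Tent

/-- The CUSUM at time `k` of a unit downward jump after time `κ` in a sample of size `n`. As a
function of `k ∈ [0, n]` it is piecewise linear, with zeros `0` and `n` and peak at `κ`. -/
noncomputable def tent (n κ k : ℝ) : ℝ := min k κ - k * κ / n

variable {n κ k c : ℝ}

lemma tent_nonneg (hκ₀ : 0 ≤ κ) (hκ : κ ≤ n) (hk₀ : 0 ≤ k) (hk : k ≤ n) : 0 ≤ tent n κ k := by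
  rcases (hk₀.trans hk).eq_or_lt with rfl | hn
  · simp [tent, hk₀, hκ₀]
  · rw [tent, sub_nonneg, div_le_iff₀ hn]
    rcases le_total k κ with h | h
    · simpa [h] using mul_le_mul_of_nonneg_left hκ hk₀
    · simpa [h, mul_comm k] using mul_le_mul_of_nonneg_left hk hκ₀

lemma mul_abs_sub_le_tent_self_sub (hn : 0 < n) (hκ : c * n ≤ κ) (hκ' : c * n ≤ n - κ) :
    c * |k - κ| ≤ tent n κ κ - tent n κ k := by
  have hc : c ≤ κ / n := (le_div_iff₀ hn).2 hκ
  have hc' : c ≤ 1 - κ / n := by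
    rw [le_sub_iff_add_le, ← le_sub_iff_add_le', div_le_iff₀ hn]
    linarith
  simp only [tent, min_self, mul_div_assoc]
  rcases le_total k κ with h | h
  · rw [min_eq_left h, abs_of_nonpos (by linarith)]
    nlinarith
  · rw [min_eq_right h, abs_of_nonneg (by linarith)]
    nlinarith

lemma tent_self_sub_le_abs_sub (hn : 0 < n) (hκ₀ : 0 ≤ κ) (hκ : κ ≤ n) :
    tent n κ κ - tent n κ k ≤ |k - κ| := by
  have h₀ : 0 ≤ κ / n := by positivity
  have h₁ : κ / n ≤ 1 := (div_le_one hn).2 hκ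
  simp only [tent, min_self, mul_div_assoc]
  rcases le_total k κ with h | h
  · rw [min_eq_left h, abs_of_nonpos (by linarith)]
    nlinarith
  · rw [min_eq_right h, abs_of_nonneg (by linarith)]
    nlinarith

lemma mul_div_two_le_tent_self (hc : 0 ≤ c) (hn : 0 < n) (hκ : c * n ≤ κ) (hκ' : c * n ≤ n - κ) :
    c * n / 2 ≤ tent n κ κ := by
  rw [tent, min_self, le_sub_iff_add_le, ← le_sub_iff_add_le', div_le_iff₀ hn]
  rcases le_total (n / 2) κ with h | h
  · linarith [mul_le_mul h hκ' (by positivity) (by linarith)]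
  · have h' : n / 2 ≤ n - κ := by linarith
    linarith [mul_le_mul hκ h' (by linarith) ((by positivity : 0 ≤ c * n).trans hκ)]

lemma half_mul_abs_sub_le_tent_sub {k' : ℝ} (hc : 0 < c) (hn : 0 < n) (hκ : c * n ≤ κ)
    (hκ' : c * n ≤ n - κ) (h_near : |k' - κ| ≤ 1) (h_far : 2 / c + 2 ≤ |k - k'|) :
    c / 2 * |k - k'| ≤ tent n κ k' - tent n κ k := by
  have h_drop := mul_abs_sub_le_tent_self_sub (k := k) hn hκ hκ'
  have h_peak : tent n κ κ - tent n κ k' ≤ |k' - κ| :=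
    tent_self_sub_le_abs_sub hn (by nlinarith) (by nlinarith)
  have h_triangle : |k - k'| ≤ |k - κ| + |k' - κ| := abs_sub_comm k' κ ▸ abs_sub_le k κ k'
  have h_far' : 2 + c * 2 ≤ c * |k - k'| := by
    calc 2 + c * 2 = c * (2 / c + 2) := by field_simp
      _ ≤ c * |k - k'| := by gcongr
  nlinarith

lemma mul_div_four_le_tent {k' : ℝ} (hc : 0 < c) (hn : 4 / c ≤ n) (hκ : c * n ≤ κ)
    (hκ' : c * n ≤ n - κ) (h_near : |k' - κ| ≤ 1) : c * n / 4 ≤ tent n κ k' := by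
  have hn₀ : 0 < n := (by positivity : 0 < 4 / c).trans_le hn
  have h_peak : tent n κ κ - tent n κ k' ≤ |k' - κ| :=
    tent_self_sub_le_abs_sub hn₀ (by nlinarith) (by nlinarith)
  linarith [mul_div_two_le_tent_self hc.le hn₀ hκ hκ', (div_le_iff₀' hc).1 hn]

end Tent

section LargeIncrement

/-- On its way along `0, …, n` the path `S` moves at speed at least `r`, between `k'` and a time
at distance at least `L` from it, or from time `0` to one of the times `k'` and `n`; in the latter
two cases the distance is counted as `n`. -/
def HasLargeIncrement (S : ℕ → ℝ) (r L : ℝ) (n k' : ℕ) : Prop :=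
  (∃ k ≤ n, L ≤ |(k : ℝ) - k'| ∧ r * |(k : ℝ) - k'| ≤ |S k - S k'|) ∨
    r * n ≤ |S n - S 0| ∨ r * n ≤ |S k' - S 0|

lemma HasLargeIncrement.mono {S : ℕ → ℝ} {r r' L : ℝ} {n k' : ℕ} (hr : r ≤ r')
    (h : HasLargeIncrement S r' L n k') : HasLargeIncrement S r L n k' := by
  have h_mul (z : ℝ) (hz : 0 ≤ z) : r * z ≤ r' * z := by gcongr
  rcases h with ⟨k, hk, hL, h⟩ | h | h
  · exact .inl ⟨k, hk, hL, (h_mul _ (abs_nonneg _)).trans h⟩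
  · exact .inr (.inl ((h_mul _ n.cast_nonneg).trans h))
  · exact .inr (.inr ((h_mul _ n.cast_nonneg).trans h))

lemma abs_mul_sub_le_or_abs_mul_add_le {d b b' w w' : ℝ} (h : |d * b' + w'| ≤ |d * b + w|) :
    |d| * (b' - b) ≤ |w - w'| ∨ |d| * (b' + b) ≤ |w - w'| + 2 * |w'| := by
  have h₁ := neg_abs_le (d * b' + w')
  have h₂ := le_abs_self (d * b' + w')
  have h₃ := neg_abs_le (w - w')
  have h₄ := le_abs_self (w - w')
  have h₅ := neg_abs_le w'
  have h₆ := le_abs_self w'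
  rcases abs_choice d with hd | hd <;> rcases abs_choice (d * b + w) with hv | hv <;>
    rw [hd] <;> rw [hv] at h
  · left; linarith
  · right; linarith
  · right; linarith
  · left; linarith

lemma abs_bridge_sub_bridge_le {n r z : ℝ} (hn : 0 < n) (hz : |z| ≤ r * n) (x y k k' : ℝ) :
    |(x - k / n * z) - (y - k' / n * z)| ≤ |x - y| + r * |k - k'| := by
  calc |(x - k / n * z) - (y - k' / n * z)| = |(x - y) - (k - k') / n * z| := by ring_nf
    _ ≤ |x - y| + |(k - k') / n * z| := abs_sub _ _
    _ = |x - y| + |k - k'| / n * |z| := by rw [abs_mul, abs_div, abs_of_pos hn]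
    _ ≤ |x - y| + |k - k'| / n * (r * n) := by gcongr
    _ = |x - y| + r * |k - k'| := by field_simp

/-- If the CUSUM at `k` beats the one at a time `k'` next to the change point, then either the
noise outweighs the difference of the tents, or it has flipped the sign of the CUSUM, in which case
it outweighs their sum. -/
lemma hasLargeIncrement_of_cusum_le {S : ℕ → ℝ} {n k k' : ℕ} {κ c d L : ℝ} (hS : S 0 = 0)
    (hc : 0 < c) (hκ : c * n ≤ κ) (hκ' : c * n ≤ n - κ) (hk : k ≤ n) (hk' : k' ≤ n)
    (h_near : |k' - κ| ≤ 1) (hL : 4 / c + 2 ≤ L) (h_far : L ≤ |(k : ℝ) - k'|)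
    (h_cusum : |d * tent n κ k' + (S k' - (k' : ℝ) / n * S n)| ≤
      |d * tent n κ k + (S k - (k : ℝ) / n * S n)|) :
    HasLargeIncrement S (c / 24 * |d|) L n k' := by
  have hkn : (k : ℝ) ≤ n := Nat.cast_le.2 hk
  have hkn' : (k' : ℝ) ≤ n := Nat.cast_le.2 hk'
  have h_dist : |(k : ℝ) - k'| ≤ n :=
    abs_sub_le_of_nonneg_of_le k.cast_nonneg hkn k'.cast_nonneg hkn'
  have h_large : 4 / c + 2 ≤ n := (hL.trans h_far).trans h_dist
  have hn : (0 : ℝ) < n := (by positivity : 0 < 4 / c + 2).trans_le h_large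
  have h_gap := half_mul_abs_sub_le_tent_sub (k := k) hc hn hκ hκ' h_near
    ((by gcongr; norm_num : 2 / c + 2 ≤ 4 / c + 2).trans (hL.trans h_far))
  have h_signal := mul_div_four_le_tent hc (by linarith) hκ hκ' h_near
  have h_nonneg : 0 ≤ tent n κ k := tent_nonneg (by nlinarith) (by nlinarith) k.cast_nonneg hkn
  by_contra! h_small
  simp only [HasLargeIncrement, hS, sub_zero, not_or, not_exists, not_and, not_le] at h_small
  obtain ⟨h_k, h_n, h_k'⟩ := h_small
  specialize h_k k hk h_far
  have h_incr := abs_bridge_sub_bridge_le hn h_n.le (S k) (S k') k k'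
  have h_bridge := abs_bridge_sub_bridge_le hn h_n.le (S k') 0 k' 0
  simp only [zero_div, zero_mul, sub_zero, Nat.abs_cast] at h_bridge
  have h_dist_le : c / 24 * |d| * |(k : ℝ) - k'| ≤ c / 24 * |d| * n := by gcongr
  have h_time_le : c / 24 * |d| * k' ≤ c / 24 * |d| * n := by gcongr
  rcases abs_mul_sub_le_or_abs_mul_add_le h_cusum with h | h
  · have := mul_le_mul_of_nonneg_left h_gap (abs_nonneg d)
    have : 0 ≤ |d| * (c * |(k : ℝ) - k'|) := by positivity
    linarith
  · have := mul_le_mul_of_nonneg_left (h_signal.trans (le_add_of_nonneg_right h_nonneg))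
      (abs_nonneg d)
    linarith

end LargeIncrement

lemma abs_sub_le_abs_ceil_sub_ceil_add_one {a b : ℝ} (ha : 0 ≤ a) (hb : 0 ≤ b) :
    |a - b| ≤ |(⌈a⌉₊ : ℝ) - ⌈b⌉₊| + 1 := by
  have ha₁ := Nat.le_ceil a
  have ha₂ := Nat.ceil_lt_add_one ha
  have hb₁ := Nat.le_ceil b
  have hb₂ := Nat.ceil_lt_add_one hb
  have h₁ := le_abs_self ((⌈a⌉₊ : ℝ) - ⌈b⌉₊)
  have h₂ := neg_abs_le ((⌈a⌉₊ : ℝ) - ⌈b⌉₊)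
  exact abs_le.2 ⟨by linarith, by linarith⟩

namespace ChangePointModel

section CusumAnalysis

variable {Ω 𝕊 : Type*} {M : ChangePointModel Ω 𝕊} {n h : ℕ}

lemma ChangeAt.sum_mean (hc : M.ChangeAt n h) {k : ℕ} (hk : k ≤ n) :
    ∑ j ∈ Finset.Icc 1 k, M.mean n j h = k * M.mean n (M.changeTime n h + 1) h +
      min (k : ℝ) (M.changeTime n h) *
        (M.mean n (M.changeTime n h) h - M.mean n (M.changeTime n h + 1) h) := by
  obtain ⟨-, -, -, -, h_before, h_after, -⟩ := hc
  induction k with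
  | zero => simp
  | succ k ih =>
    rw [Finset.sum_Icc_succ_top (by omega), ih (by omega), ← Nat.cast_min, ← Nat.cast_min]
    rcases le_or_gt (k + 1) (M.changeTime n h) with hle | hgt
    · rw [min_eq_left hle, min_eq_left (by omega),
        h_before (k + 1) (Finset.mem_Icc.2 ⟨by omega, hle⟩)]
      push_cast
      ring
    · rw [min_eq_right hgt.le, min_eq_right (by omega),
        h_after (k + 1) (Finset.mem_Icc.2 ⟨hgt, hk⟩)]
      push_cast
      ring

lemma ChangeAt.cusum_eq (hc : M.ChangeAt n h) (ω : Ω) {t : ℝ} (ht : t ≤ 1) :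
    M.cusum n h ω t = (n : ℝ) ^ (-(1 / 2) : ℝ) *
      |(M.mean n (M.changeTime n h) h - M.mean n (M.changeTime n h + 1) h) *
          tent n (M.changeTime n h) ⌈n * t⌉₊ +
        (M.noiseSum h ⌈n * t⌉₊ ω - (⌈n * t⌉₊ : ℝ) / n * M.noiseSum h n ω)| := by
  obtain ⟨-, -, -, hκ, -⟩ := id hc
  have hn : (0 : ℝ) < n := Nat.cast_pos.2 (by omega)
  have hk : ⌈n * t⌉₊ ≤ n := Nat.ceil_le.2 (mul_le_of_le_one_right hn.le ht)
  have h_obs (k : ℕ) : ∑ j ∈ Finset.Icc 1 k, M.obs n j h ω =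
      ∑ j ∈ Finset.Icc 1 k, M.mean n j h + M.noiseSum h k ω := Finset.sum_add_distrib
  have h_min : min (n : ℝ) (M.changeTime n h) = M.changeTime n h :=
    min_eq_right (Nat.cast_le.2 hκ.le)
  rw [cusum, h_obs, h_obs, hc.sum_mean hk, hc.sum_mean le_rfl, h_min, tent]
  congr 2
  field_simp
  ring

lemma ChangeAt.half_mul_le_changeTime {t : ℝ} (hc : M.ChangeAt n h) (ht : t ≤ M.frac n h) :
    t / 2 * n ≤ M.changeTime n h := by
  have h_floor : M.frac n h * n < M.changeTime n h + 1 := Nat.lt_floor_add_one _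
  have h_one : (1 : ℝ) ≤ M.changeTime n h := Nat.one_le_cast.2 hc.2.2.1
  linarith [mul_le_mul_of_nonneg_right ht n.cast_nonneg]

lemma abs_ceil_sub_changeTime_le (M : ChangePointModel Ω 𝕊) (n h : ℕ) :
    |(⌈n * M.frac n h⌉₊ : ℝ) - M.changeTime n h| ≤ 1 := by
  have h_ceil : ⌈n * M.frac n h⌉₊ ≤ M.changeTime n h + 1 := by
    rw [changeTime, mul_comm]
    exact Nat.ceil_le_floor_add_one _
  have h_floor : M.changeTime n h ≤ ⌈n * M.frac n h⌉₊ := by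
    rw [changeTime, mul_comm]
    exact Nat.floor_le_ceil _
  have h_ceil' : (⌈n * M.frac n h⌉₊ : ℝ) ≤ M.changeTime n h + 1 := by exact_mod_cast h_ceil
  exact abs_le.2 ⟨by linarith [(Nat.cast_le (α := ℝ)).2 h_floor], by linarith⟩

lemma ChangeAt.hasLargeIncrement_noiseSum {𝔱 s x : ℝ} {ω : Ω} (h𝔱 : 0 < 𝔱)
    (hc : M.ChangeAt n h) (hτ : M.frac n h ∈ Set.Ioo 𝔱 (1 - 𝔱))
    (hs : M.IsArgmaxCusum 𝔱 n h ω s) (hx : 8 / 𝔱 + 3 ≤ n * x) (hsx : x ≤ |s - M.frac n h|) :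
    HasLargeIncrement (fun k => M.noiseSum h k ω) (𝔱 / 48 * M.jump n h) (n * x - 1) n
      ⌈n * M.frac n h⌉₊ := by
  obtain ⟨⟨h𝔱s, hs₁⟩, h_max⟩ := hs
  have hs₀ : 0 < s := h𝔱.trans h𝔱s
  have hτ₀ : 0 < M.frac n h := h𝔱.trans hτ.1
  have hn : (0 : ℝ) < n := Nat.cast_pos.2 (by have := hc.2.2.2.1; omega)
  have h_ceil {t : ℝ} (ht : t ≤ 1) : ⌈n * t⌉₊ ≤ n :=
    Nat.ceil_le.2 (mul_le_of_le_one_right hn.le ht)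
  have h_floor : (M.changeTime n h : ℝ) ≤ M.frac n h * n := Nat.floor_le (by positivity)
  have h_far : n * x - 1 ≤ |(⌈n * s⌉₊ : ℝ) - ⌈n * M.frac n h⌉₊| := by
    have h_dist : n * x ≤ |n * s - n * M.frac n h| := by
      rw [← mul_sub, abs_mul, Nat.abs_cast]
      gcongr
    linarith [abs_sub_le_abs_ceil_sub_ceil_add_one (by positivity : 0 ≤ n * s)
      (by positivity : 0 ≤ n * M.frac n h)]
  have h_cusum : M.cusum n h ω (M.frac n h) ≤ M.cusum n h ω s := h_max hτ
  rw [hc.cusum_eq ω (by linarith [hτ.2]), hc.cusum_eq ω (by linarith)] at h_cusum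
  have h_right : 𝔱 / 2 * n ≤ n - M.changeTime n h := by nlinarith [hτ.2]
  have h_threshold : 4 / (𝔱 / 2) + 2 ≤ n * x - 1 := by
    rw [div_div_eq_mul_div]
    linarith
  have h_large := hasLargeIncrement_of_cusum_le (S := fun k => M.noiseSum h k ω)
    (M.noiseSum_zero h ω) (half_pos h𝔱)
    (hc.half_mul_le_changeTime hτ.1.le) h_right (h_ceil (by linarith))
    (h_ceil (by linarith [hτ.2])) (M.abs_ceil_sub_changeTime_le n h) h_threshold h_far
    (le_of_mul_le_mul_left h_cusum (Real.rpow_pos_of_pos hn _))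
  rwa [div_div, show (2 : ℝ) * 24 = 48 by norm_num] at h_large

end CusumAnalysis

end ChangePointModel

section LargeIncrementProbability

variable {Ω : Type*} [MeasurableSpace Ω] {P : Measure Ω} {S : ℕ → Ω → ℝ} {p C c r L : ℝ}

lemma HasFukNagaevIncrements.measureReal_mul_le_abs_sub_le
    (hS : HasFukNagaevIncrements P S p C c) (hC : 0 ≤ C) (hr : 0 < r) {n d : ℕ} (hd : 1 ≤ d)
    (hdn : d ≤ n) (h_rate : p * Real.log n ≤ c * (r ^ 2 * d)) {i k : ℕ} (hk : k ≤ i + d)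
    (hi : i ≤ k + d) :
    P.real {ω | r * d ≤ |S k ω - S i ω|} ≤
      C * ((r ^ p)⁻¹ * (d : ℝ) ^ (1 - p)) + C * (n : ℝ) ^ (2 - p) := by
  have hd₀ : (0 : ℝ) < d := Nat.cast_pos.2 hd
  have hn₀ : (0 : ℝ) < n := Nat.cast_pos.2 (hd.trans hdn)
  have h_poly : (d : ℝ) / (r * d) ^ p = (r ^ p)⁻¹ * (d : ℝ) ^ (1 - p) := by
    rw [Real.mul_rpow hr.le hd₀.le, Real.rpow_sub hd₀, Real.rpow_one]
    field_simp
  have h_exp : Real.exp (-(c * (r * d) ^ 2 / d)) ≤ (n : ℝ) ^ (-p) := by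
    rw [Real.rpow_def_of_pos hn₀, Real.exp_le_exp,
      show c * (r * d) ^ 2 / d = c * (r ^ 2 * d) by field_simp]
    linarith
  calc P.real {ω | r * d ≤ |S k ω - S i ω|}
      ≤ C * (d / (r * d) ^ p) + C * (d : ℝ) ^ 2 * Real.exp (-(c * (r * d) ^ 2 / d)) :=
        hS i k d hd hk hi (r * d) (by positivity)
    _ ≤ C * (d / (r * d) ^ p) + C * (n : ℝ) ^ 2 * (n : ℝ) ^ (-p) := by gcongr
    _ = C * ((r ^ p)⁻¹ * (d : ℝ) ^ (1 - p)) + C * (n : ℝ) ^ (2 - p) := by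
        rw [h_poly, mul_assoc, ← Real.rpow_natCast, ← Real.rpow_add hn₀, Nat.cast_ofNat,
          ← sub_eq_add_neg]

lemma HasLargeIncrement.exists_lag {S : ℕ → ℝ} {n k' : ℕ} (hk' : k' ≤ n)
    (h : HasLargeIncrement S r L n k') :
    (∃ d ∈ Finset.Icc ⌈L⌉₊ n,
      r * d ≤ |S (k' + d) - S k'| ∨ r * d ≤ |S (k' - d) - S k'|) ∨
    r * n ≤ |S n - S 0| ∨ r * n ≤ |S k' - S 0| := by
  refine h.imp_left fun ⟨k, hk, hL, h_incr⟩ => ?_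
  rcases le_total k' k with hle | hle <;> obtain ⟨d, rfl⟩ := Nat.exists_eq_add_of_le hle
  · simp only [Nat.cast_add, add_sub_cancel_left, Nat.abs_cast] at hL h_incr
    exact ⟨d, Finset.mem_Icc.2 ⟨Nat.ceil_le.2 hL, by omega⟩, .inl h_incr⟩
  · simp only [Nat.cast_add, sub_add_cancel_left, abs_neg, Nat.abs_cast] at hL h_incr
    exact ⟨d, Finset.mem_Icc.2 ⟨Nat.ceil_le.2 hL, by omega⟩, .inr (by simpa using h_incr)⟩

lemma HasFukNagaevIncrements.measureReal_hasLargeIncrement_le_sum [IsFiniteMeasure P]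
    (hS : HasFukNagaevIncrements P S p C c) (hC : 0 ≤ C) (hc : 0 ≤ c) (hr : 0 < r) (hL : 0 < L)
    {n k' : ℕ} (hLn : L ≤ n) (hk' : k' ≤ n) (h_rate : p * Real.log n ≤ c * (r ^ 2 * L)) :
    P.real {ω | HasLargeIncrement (S · ω) r L n k'} ≤
      ∑ d ∈ Finset.Icc ⌈L⌉₊ n,
        2 * (C * ((r ^ p)⁻¹ * (d : ℝ) ^ (1 - p)) + C * (n : ℝ) ^ (2 - p)) +
      2 * (C * ((r ^ p)⁻¹ * (n : ℝ) ^ (1 - p)) + C * (n : ℝ) ^ (2 - p)) := by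
  have h_lag (i k d : ℕ) (hLd : ⌈L⌉₊ ≤ d) (hdn : d ≤ n) (hk : k ≤ i + d) (hi : i ≤ k + d) :
      P.real {ω | r * d ≤ |S k ω - S i ω|} ≤
        C * ((r ^ p)⁻¹ * (d : ℝ) ^ (1 - p)) + C * (n : ℝ) ^ (2 - p) :=
    hS.measureReal_mul_le_abs_sub_le hC hr ((Nat.ceil_pos.2 hL).trans_le hLd) hdn
      (h_rate.trans (by gcongr; exact Nat.ceil_le.1 hLd)) hk hi
  have h_pair (A B : Set Ω) {t : ℝ} (hA : P.real A ≤ t) (hB : P.real B ≤ t) :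
      P.real (A ∪ B) ≤ 2 * t := (measureReal_union_le A B).trans (by linarith)
  have h_cover : {ω | HasLargeIncrement (S · ω) r L n k'} ⊆
      (⋃ d ∈ Finset.Icc ⌈L⌉₊ n, ({ω | r * d ≤ |S (k' + d) ω - S k' ω|} ∪
        {ω | r * d ≤ |S (k' - d) ω - S k' ω|})) ∪
      ({ω | r * n ≤ |S n ω - S 0 ω|} ∪ {ω | r * n ≤ |S k' ω - S 0 ω|}) := fun ω hω => by
    simpa only [Set.mem_union, Set.mem_iUnion, Set.mem_ofPred_eq, exists_prop] using
      HasLargeIncrement.exists_lag hk' hω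
  have hLn' : ⌈L⌉₊ ≤ n := Nat.ceil_le.2 hLn
  refine (measureReal_mono h_cover).trans <| (measureReal_union_le _ _).trans <| add_le_add
    ((measureReal_biUnion_finset_le _ _).trans <| Finset.sum_le_sum fun d hd => ?_) ?_
  · obtain ⟨hLd, hdn⟩ := Finset.mem_Icc.1 hd
    exact h_pair _ _ (h_lag k' (k' + d) d hLd hdn le_rfl (by omega))
      (h_lag k' (k' - d) d hLd hdn (by omega) (by omega))
  · exact h_pair _ _ (h_lag 0 n n hLn' le_rfl (by omega) (by omega))
      (h_lag 0 k' n hLn' le_rfl (by omega) (by omega))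

lemma sum_Icc_rpow_one_sub_le (hp : 3 ≤ p) {k : ℕ} (hk : 1 ≤ k) (n : ℕ) :
    ∑ d ∈ Finset.Icc k n, (d : ℝ) ^ (1 - p) ≤ 2 * (k : ℝ) ^ (2 - p) := by
  have hk₀ : (0 : ℝ) < k := Nat.cast_pos.2 hk
  have h_Icc : Finset.Icc k n = Finset.Ioo (k - 1) (n + 1) := by
    ext d
    simp only [Finset.mem_Icc, Finset.mem_Ioo]
    omega
  have h_term (d : ℕ) (hd : d ∈ Finset.Icc k n) :
      (d : ℝ) ^ (1 - p) ≤ (k : ℝ) ^ (3 - p) * ((d : ℝ) ^ 2)⁻¹ := by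
    have hkd : (k : ℝ) ≤ d := Nat.cast_le.2 (Finset.mem_Icc.1 hd).1
    have hd₀ : (0 : ℝ) < d := hk₀.trans_le hkd
    calc (d : ℝ) ^ (1 - p) = (d : ℝ) ^ (3 - p) * ((d : ℝ) ^ 2)⁻¹ := by
          rw [← Real.rpow_natCast, ← Real.rpow_neg hd₀.le, ← Real.rpow_add hd₀]
          congr 1
          push_cast
          ring
      _ ≤ (k : ℝ) ^ (3 - p) * ((d : ℝ) ^ 2)⁻¹ := by
          gcongr ?_ * _
          exact Real.rpow_le_rpow_of_nonpos hk₀ hkd (by linarith)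
  have h_sq : ∑ d ∈ Finset.Icc k n, ((d : ℝ) ^ 2)⁻¹ ≤ 2 / k := by
    have h_Ioo := sum_Ioo_inv_sq_le (α := ℝ) (k - 1) (n + 1)
    rwa [← h_Icc, Nat.cast_sub hk, Nat.cast_one, sub_add_cancel] at h_Ioo
  calc ∑ d ∈ Finset.Icc k n, (d : ℝ) ^ (1 - p)
      ≤ (k : ℝ) ^ (3 - p) * ∑ d ∈ Finset.Icc k n, ((d : ℝ) ^ 2)⁻¹ := by
        rw [Finset.mul_sum]
        exact Finset.sum_le_sum h_term
    _ ≤ (k : ℝ) ^ (3 - p) * (2 / k) := by gcongr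
    _ = 2 * (k : ℝ) ^ (2 - p) := by
        rw [show 3 - p = 2 - p + 1 by ring, Real.rpow_add_one hk₀.ne']
        field_simp

lemma HasFukNagaevIncrements.measureReal_hasLargeIncrement_le [IsFiniteMeasure P]
    (hS : HasFukNagaevIncrements P S p C c) (hp : 3 ≤ p) (hC : 0 ≤ C) (hc : 0 ≤ c) (hr : 0 < r)
    (hL : 1 ≤ L) {n k' : ℕ} (hLn : L ≤ n) (hk' : k' ≤ n)
    (h_rate : p * Real.log n ≤ c * (r ^ 2 * L)) :
    P.real {ω | HasLargeIncrement (S · ω) r L n k'} ≤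
      C * (6 * ((r ^ p)⁻¹ * L ^ (2 - p)) + 4 * (n : ℝ) ^ (3 - p)) := by
  have hL₀ : 0 < L := by linarith
  have hn : (1 : ℝ) ≤ n := hL.trans hLn
  have h_card : ((Finset.Icc ⌈L⌉₊ n).card : ℝ) ≤ n := by
    rw [Nat.card_Icc]
    exact Nat.cast_le.2 (by have := Nat.ceil_pos.2 hL₀; omega)
  have h_lags : ∑ d ∈ Finset.Icc ⌈L⌉₊ n, (d : ℝ) ^ (1 - p) ≤ 2 * L ^ (2 - p) := by
    refine (sum_Icc_rpow_one_sub_le hp (Nat.ceil_pos.2 hL₀) n).trans ?_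
    gcongr ?_ * ?_
    exact Real.rpow_le_rpow_of_nonpos hL₀ (Nat.le_ceil L) (by linarith)
  have h_last : (n : ℝ) ^ (1 - p) ≤ L ^ (2 - p) :=
    (Real.rpow_le_rpow_of_exponent_le hn (by linarith)).trans
      (Real.rpow_le_rpow_of_nonpos hL₀ hLn (by linarith))
  have h_exp : (n : ℝ) ^ (2 - p) ≤ (n : ℝ) ^ (3 - p) :=
    Real.rpow_le_rpow_of_exponent_le hn (by linarith)
  have h_succ : (n : ℝ) * (n : ℝ) ^ (2 - p) = (n : ℝ) ^ (3 - p) := by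
    rw [mul_comm, ← Real.rpow_add_one (by positivity)]
    congr 1
    ring
  calc P.real {ω | HasLargeIncrement (S · ω) r L n k'} ≤ _ :=
        hS.measureReal_hasLargeIncrement_le_sum hC hc hr hL₀ hLn hk' h_rate
    _ = 2 * C * (r ^ p)⁻¹ * ∑ d ∈ Finset.Icc ⌈L⌉₊ n, (d : ℝ) ^ (1 - p) +
        2 * C * ((Finset.Icc ⌈L⌉₊ n).card * (n : ℝ) ^ (2 - p)) +
        2 * (C * ((r ^ p)⁻¹ * (n : ℝ) ^ (1 - p)) + C * (n : ℝ) ^ (2 - p)) := by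
        simp only [← Finset.mul_sum, Finset.sum_add_distrib, Finset.sum_const, nsmul_eq_mul]
        ring
    _ ≤ 2 * C * (r ^ p)⁻¹ * (2 * L ^ (2 - p)) + 2 * C * (n * (n : ℝ) ^ (2 - p)) +
        2 * (C * ((r ^ p)⁻¹ * L ^ (2 - p)) + C * (n : ℝ) ^ (3 - p)) := by gcongr
    _ = C * (6 * ((r ^ p)⁻¹ * L ^ (2 - p)) + 4 * (n : ℝ) ^ (3 - p)) := by
        rw [h_succ]
        ring

lemma inv_rpow_mul_rpow_two_sub_le {K l : ℝ} (hp : 0 ≤ p) (hK : 0 < K) (hl : 0 < l) (hL : 0 < L)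
    (hr : 0 ≤ r) (h : K * l ≤ r ^ 2 * L) :
    (r ^ p)⁻¹ * L ^ (2 - p) ≤ K ^ (-(p / 2)) * (l ^ 2)⁻¹ * (L * l) ^ (-p / 2 + 2) := by
  have h_rate : (K * l / L) ^ (p / 2) ≤ r ^ p := by
    calc (K * l / L) ^ (p / 2) ≤ (r ^ 2) ^ (p / 2) := by
          gcongr
          rwa [div_le_iff₀ hL]
      _ = r ^ p := by
          rw [← Real.rpow_natCast, ← Real.rpow_mul hr, Nat.cast_ofNat,
            mul_div_cancel₀ _ two_ne_zero]
  have h_L : L ^ (-p / 2 + 2) = L ^ (p / 2) * L ^ (2 - p) := by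
    rw [← Real.rpow_add hL]
    congr 1
    ring
  have h_l : l ^ (-p / 2 + 2) = (l ^ (p / 2))⁻¹ * l ^ 2 := by
    rw [← Real.rpow_natCast, ← Real.rpow_neg hl.le, ← Real.rpow_add hl, neg_div, Nat.cast_ofNat]
  calc (r ^ p)⁻¹ * L ^ (2 - p) ≤ ((K * l / L) ^ (p / 2))⁻¹ * L ^ (2 - p) := by gcongr
    _ = K ^ (-(p / 2)) * (l ^ 2)⁻¹ * (L * l) ^ (-p / 2 + 2) := by
        rw [Real.div_rpow (by positivity) hL.le, Real.mul_rpow hK.le hl.le,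
          Real.mul_rpow hL.le hl.le, h_L, h_l, Real.rpow_neg hK.le]
        field_simp

lemma rpow_three_sub_le {x l : ℝ} (hp : 4 ≤ p) (hx : 1 ≤ x) (hL : 0 < L) (hLx : L ≤ x)
    (hl : 0 < l) (hlx : l ≤ x) : x ^ (3 - p) ≤ (L * l) ^ (-p / 2 + 2) := by
  have hx₀ : 0 < x := by linarith
  calc x ^ (3 - p) ≤ x ^ (4 - p) := Real.rpow_le_rpow_of_exponent_le hx (by linarith)
    _ = (x * x) ^ (-p / 2 + 2) := by
        rw [Real.mul_rpow hx₀.le hx₀.le, ← Real.rpow_add hx₀]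
        congr 1
        ring
    _ ≤ (L * l) ^ (-p / 2 + 2) :=
        Real.rpow_le_rpow_of_nonpos (by positivity) (by gcongr) (by linarith)

lemma HasFukNagaevIncrements.measureReal_hasLargeIncrement_le_rpow [IsFiniteMeasure P]
    (hS : HasFukNagaevIncrements P S p C c) (hp : 4 ≤ p) (hC : 0 ≤ C) (hc : 0 < c) (hr : 0 < r)
    (hL : 1 ≤ L) {n k' : ℕ} (hn : 2 ≤ n) (hLn : L ≤ n) (hk' : k' ≤ n)
    (h_rate : p / c * Real.log n ≤ r ^ 2 * L) :
    P.real {ω | HasLargeIncrement (S · ω) r L n k'} ≤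
      C * (6 * ((p / c) ^ (-(p / 2)) * (Real.log 2 ^ 2)⁻¹) + 4) *
        (L * Real.log n) ^ (-p / 2 + 2) := by
  have hn₂ : (2 : ℝ) ≤ n := Nat.ofNat_le_cast.2 hn
  have h_log₂ : 0 < Real.log 2 := Real.log_pos one_lt_two
  have h_log : Real.log 2 ≤ Real.log n := Real.log_le_log two_pos hn₂
  have h_heavy := inv_rpow_mul_rpow_two_sub_le (by linarith : 0 ≤ p) (by positivity)
    (h_log₂.trans_le h_log) (by linarith) hr.le h_rate
  have h_light := rpow_three_sub_le hp (by linarith) (by linarith : 0 < L) hLn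
    (h_log₂.trans_le h_log) (Real.log_le_self n.cast_nonneg)
  calc P.real {ω | HasLargeIncrement (S · ω) r L n k'}
      ≤ C * (6 * ((r ^ p)⁻¹ * L ^ (2 - p)) + 4 * (n : ℝ) ^ (3 - p)) :=
        hS.measureReal_hasLargeIncrement_le (by linarith) hC hc.le hr hL hLn hk'
          (by rwa [div_mul_eq_mul_div, div_le_iff₀' hc] at h_rate)
    _ ≤ C * (6 * ((p / c) ^ (-(p / 2)) * (Real.log n ^ 2)⁻¹ *
          (L * Real.log n) ^ (-p / 2 + 2)) + 4 * (L * Real.log n) ^ (-p / 2 + 2)) := by gcongr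
    _ ≤ C * (6 * ((p / c) ^ (-(p / 2)) * (Real.log 2 ^ 2)⁻¹ *
          (L * Real.log n) ^ (-p / 2 + 2)) + 4 * (L * Real.log n) ^ (-p / 2 + 2)) := by gcongr
    _ = C * (6 * ((p / c) ^ (-(p / 2)) * (Real.log 2 ^ 2)⁻¹) + 4) *
          (L * Real.log n) ^ (-p / 2 + 2) := by ring

end LargeIncrementProbability

lemma one_le_rpow_of_mul_lt {q K c D δ x n l : ℝ} (hq : 0 ≤ q) (hK : 0 < K) (hδ : 0 < δ)
    (hδD : δ ≤ D) (hn : 0 < n) (hl : 0 < l) (hx : K * (l / (δ ^ 2 * n)) ≤ x) (hnx : n * x < c) :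
    1 ≤ (c ^ 2 * D ^ 2 / K) ^ q * (x * n * l) ^ (-q) := by
  have hx₀ : 0 < x := (by positivity : 0 < K * (l / (δ ^ 2 * n))).trans_le hx
  have hc : 0 < c := (mul_pos hn hx₀).trans hnx
  have h_log : K * l ≤ D ^ 2 * c := by
    calc K * l = δ ^ 2 * (n * (K * (l / (δ ^ 2 * n)))) := by field_simp
      _ ≤ δ ^ 2 * (n * x) := by gcongr
      _ ≤ D ^ 2 * c := by gcongr
  have h_base : x * n * l ≤ c ^ 2 * D ^ 2 / K := by
    calc x * n * l = (n * x) * (K * l) / K := by field_simp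
      _ ≤ c * (D ^ 2 * c) / K := by gcongr
      _ = c ^ 2 * D ^ 2 / K := by ring
  calc (1 : ℝ) = (x * n * l) ^ q * (x * n * l) ^ (-q) := by
        rw [← Real.rpow_add (by positivity), add_neg_cancel, Real.rpow_zero]
    _ ≤ (c ^ 2 * D ^ 2 / K) ^ q * (x * n * l) ^ (-q) := by gcongr

namespace ChangePointModel

section MaxError

variable {Ω 𝕊 : Type*} {M : ChangePointModel Ω 𝕊} {τhat : ℕ → ℕ → Ω → ℝ} {n h : ℕ}

lemma mem_changeSet : h ∈ M.changeSet n ↔ h < M.dim n ∧ M.ChangeAt n h := by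
  simp [changeSet]

lemma card_changeSet_le_dim (M : ChangePointModel Ω 𝕊) (n : ℕ) :
    (M.changeSet n).card ≤ M.dim n := by
  classical
  exact (Finset.card_filter_le _ _).trans_eq (Finset.card_range _)

lemma ChangeAt.jump_pos (hc : M.ChangeAt n h) : 0 < M.jump n h :=
  abs_pos.2 (sub_ne_zero.2 hc.2.2.2.2.2.2)

lemma minJump_le_jump (hh : h ∈ M.changeSet n) : M.minJump n ≤ M.jump n h :=
  ciInf_le (f := fun h : M.changeSet n => M.jump n h) (Set.finite_range _).bddBelow ⟨h, hh⟩

lemma minJump_pos (hn : (M.changeSet n).Nonempty) : 0 < M.minJump n := by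
  have : Nonempty (M.changeSet n) := hn.to_subtype
  obtain ⟨h, hh⟩ := exists_eq_ciInf_of_finite (f := fun h : M.changeSet n => M.jump n h)
  rw [minJump, ← hh]
  exact (mem_changeSet.1 h.2).2.jump_pos

lemma maxError_nonneg (M : ChangePointModel Ω 𝕊) (τhat : ℕ → ℕ → Ω → ℝ) (n : ℕ) (ω : Ω) :
    0 ≤ M.maxError τhat n ω :=
  Real.iSup_nonneg fun _ => abs_nonneg _

lemma exists_le_abs_of_le_maxError {ω : Ω} {x : ℝ} (hn : (M.changeSet n).Nonempty)
    (hx : x ≤ M.maxError τhat n ω) : ∃ h ∈ M.changeSet n, x ≤ |τhat n h ω - M.frac n h| := by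
  have : Nonempty (M.changeSet n) := hn.to_subtype
  obtain ⟨h, hh⟩ := exists_eq_ciSup_of_finite
    (f := fun h : M.changeSet n => |τhat n h ω - M.frac n h|)
  exact ⟨h, h.2, hx.trans_eq hh.symm⟩

lemma IsArgmaxCusum.abs_sub_frac_lt_one {𝔱 s : ℝ} {ω : Ω} (hs : M.IsArgmaxCusum 𝔱 n h ω s)
    (h𝔱 : 0 < 𝔱) (hτ : M.frac n h ∈ Set.Ioo 𝔱 (1 - 𝔱)) : |s - M.frac n h| < 1 :=
  abs_lt.2 ⟨by linarith [hs.1.1, hτ.2], by linarith [hs.1.2, hτ.1]⟩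

variable [MeasurableSpace Ω] {P : Measure Ω} [IsProbabilityMeasure P] {p 𝔱 C c δ x : ℝ}

lemma ChangeAt.measureReal_le_abs_sub_frac_le (hc : M.ChangeAt n h) (hp : 4 ≤ p) (h𝔱 : 0 < 𝔱)
    (hC : 0 ≤ C) (hc₀ : 0 < c) (hn : 2 ≤ n) (hτ : M.frac n h ∈ Set.Ioo 𝔱 (1 - 𝔱))
    (hS : HasFukNagaevIncrements P (M.noiseSum h) p C c) {s : Ω → ℝ}
    (hs : ∀ ω, M.IsArgmaxCusum 𝔱 n h ω (s ω)) (hδ : 0 < δ) (hδ_le : δ ≤ M.jump n h)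
    (hx : 2 * p / (c * (𝔱 / 48) ^ 2) * (Real.log n / (δ ^ 2 * n)) ≤ x)
    (hnx : 8 / 𝔱 + 3 ≤ n * x) :
    P.real {ω | x ≤ |s ω - M.frac n h|} ≤
      C * (6 * ((p / c) ^ (-(p / 2)) * (Real.log 2 ^ 2)⁻¹) + 4) * 2 ^ (p / 2 - 2) *
        (x * n * Real.log n) ^ (-(p / 2 - 2)) := by
  have hn₀ : (0 : ℝ) < n := Nat.cast_pos.2 (by omega)
  have h_log : 0 < Real.log n := Real.log_pos (Nat.one_lt_cast.2 hn)
  have hx₀ : 0 < x := pos_of_mul_pos_right ((by positivity : 0 < 8 / 𝔱 + 3).trans_le hnx) hn₀.le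
  have h𝔱₈ : 0 < 8 / 𝔱 := by positivity
  rcases lt_or_ge 1 x with h_one | h_one
  · have h_empty : {ω | x ≤ |s ω - M.frac n h|} = ∅ :=
      Set.eq_empty_of_forall_notMem fun ω hω =>
        ((hs ω).abs_sub_frac_lt_one h𝔱 hτ).not_ge (h_one.le.trans hω)
    rw [h_empty, measureReal_empty]
    positivity
  have hL : n * x / 2 ≤ n * x - 1 := by linarith
  have h_rate : p / c * Real.log n ≤ (𝔱 / 48 * δ) ^ 2 * (n * x - 1) := by
    calc p / c * Real.log n = (𝔱 / 48 * δ) ^ 2 *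
          (n * (2 * p / (c * (𝔱 / 48) ^ 2) * (Real.log n / (δ ^ 2 * n))) / 2) := by field_simp
      _ ≤ (𝔱 / 48 * δ) ^ 2 * (n * x - 1) := by
        gcongr
        exact le_trans (by gcongr) hL
  calc P.real {ω | x ≤ |s ω - M.frac n h|}
      ≤ P.real {ω | HasLargeIncrement (fun k => M.noiseSum h k ω) (𝔱 / 48 * δ) (n * x - 1) n
          ⌈n * M.frac n h⌉₊} := measureReal_mono fun ω hω =>
        (hc.hasLargeIncrement_noiseSum h𝔱 hτ (hs ω) hnx hω).mono (by gcongr)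
    _ ≤ C * (6 * ((p / c) ^ (-(p / 2)) * (Real.log 2 ^ 2)⁻¹) + 4) *
        ((n * x - 1) * Real.log n) ^ (-p / 2 + 2) :=
      hS.measureReal_hasLargeIncrement_le_rpow hp hC hc₀ (by positivity) (by linarith) hn
        (by nlinarith) (Nat.ceil_le.2 (by nlinarith [hτ.2])) h_rate
    _ ≤ C * (6 * ((p / c) ^ (-(p / 2)) * (Real.log 2 ^ 2)⁻¹) + 4) *
        (x * n * Real.log n / 2) ^ (-(p / 2 - 2)) := by
      rw [show -p / 2 + 2 = -(p / 2 - 2) by ring]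
      gcongr ?_ * ?_
      refine Real.rpow_le_rpow_of_nonpos (by positivity) ?_ (by linarith)
      calc x * n * Real.log n / 2 = n * x / 2 * Real.log n := by ring
        _ ≤ (n * x - 1) * Real.log n := by gcongr
    _ = _ := by
      rw [Real.div_rpow (by positivity) zero_le_two, Real.rpow_neg zero_le_two, div_inv_eq_mul]
      ring

end MaxError

end ChangePointModel

namespace ChangePointModel

section Deviation

variable {Ω 𝕊 : Type*} {M : ChangePointModel Ω 𝕊} {τhat : ℕ → ℕ → Ω → ℝ} [MeasurableSpace Ω]
  {P : Measure Ω} {p C : ℝ}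

lemma measureReal_le_maxError_le_of_forall [IsFiniteMeasure P] {n : ℕ} {x b : ℝ}
    (hn : (M.changeSet n).Nonempty)
    (hb : ∀ h ∈ M.changeSet n, P.real {ω | x ≤ |τhat n h ω - M.frac n h|} ≤ b) :
    P.real {ω | x ≤ M.maxError τhat n ω} ≤ (M.changeSet n).card * b := by
  have h_cover : {ω | x ≤ M.maxError τhat n ω} ⊆
      ⋃ h ∈ M.changeSet n, {ω | x ≤ |τhat n h ω - M.frac n h|} := fun ω hω => by
    simpa only [Set.mem_iUnion, Set.mem_ofPred_eq, exists_prop] using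
      exists_le_abs_of_le_maxError hn hω
  calc P.real {ω | x ≤ M.maxError τhat n ω}
      ≤ ∑ h ∈ M.changeSet n, P.real {ω | x ≤ |τhat n h ω - M.frac n h|} :=
        (measureReal_mono h_cover (measure_ne_top _ _)).trans
          (measureReal_biUnion_finset_le _ _)
    _ ≤ (M.changeSet n).card * b := by
        simpa only [nsmul_eq_mul] using Finset.sum_le_card_nsmul _ _ _ hb

theorem exists_measureReal_le_maxError_le {𝔱 c : ℝ} (hp : 4 ≤ p) (h𝔱 : 0 < 𝔱) (hC : 0 < C)
    (hc : 0 < c) (D : ℝ) :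
    ∃ C' : ℝ, 0 < C' ∧ ∀ {Ω 𝕊 : Type*} [MeasurableSpace Ω] {P : Measure Ω}
      [IsProbabilityMeasure P] {M : ChangePointModel Ω 𝕊} {τhat : ℕ → ℕ → Ω → ℝ} {n : ℕ},
      2 ≤ n → (M.changeSet n).Nonempty → M.minJump n ≤ D →
      (∀ h ∈ M.changeSet n, M.frac n h ∈ Set.Ioo 𝔱 (1 - 𝔱)) →
      (∀ h, HasFukNagaevIncrements P (M.noiseSum h) p C c) →
      (∀ h ∈ M.changeSet n, ∀ ω, M.IsArgmaxCusum 𝔱 n h ω (τhat n h ω)) →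
      ∀ x : ℝ, 2 * p / (c * (𝔱 / 48) ^ 2) * (Real.log n / (M.minJump n ^ 2 * n)) ≤ x →
        P.real {ω | x ≤ M.maxError τhat n ω} ≤
          C' * (M.changeSet n).card * (x * n * Real.log n) ^ (-p / 2 + 2) := by
  have : 0 < Real.log 2 := Real.log_pos one_lt_two
  set K := 2 * p / (c * (𝔱 / 48) ^ 2)
  set C₁ := C * (6 * ((p / c) ^ (-(p / 2)) * (Real.log 2 ^ 2)⁻¹) + 4) * 2 ^ (p / 2 - 2)
  set C₂ := ((8 / 𝔱 + 3) ^ 2 * D ^ 2 / K) ^ (p / 2 - 2)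
  have hK₀ : 0 < K := by positivity
  have hC₁₀ : 0 < C₁ := by positivity
  have hC₂₀ : 0 ≤ C₂ := by positivity
  refine ⟨C₁ + C₂, by positivity, ?_⟩
  intro Ω 𝕊 _ P _ M τhat n hn hne hD hτ hS hτhat x hx
  have h_log : 0 < Real.log n := Real.log_pos (Nat.one_lt_cast.2 hn)
  have hx₀ : 0 ≤ x := le_trans (by positivity) hx
  have h_card : (1 : ℝ) ≤ (M.changeSet n).card := Nat.one_le_cast.2 hne.card_pos
  rw [show -p / 2 + 2 = -(p / 2 - 2) by ring]
  set b := (x * n * Real.log n) ^ (-(p / 2 - 2))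
  have : 0 ≤ b := by positivity
  rcases lt_or_ge (n * x) (8 / 𝔱 + 3) with hnx | hnx
  · calc P.real {ω | x ≤ M.maxError τhat n ω} ≤ 1 := measureReal_le_one
      _ ≤ C₂ * b := one_le_rpow_of_mul_lt (by linarith) hK₀ (minJump_pos hne) hD
          (Nat.cast_pos.2 (by omega)) h_log hx hnx
      _ ≤ (C₁ + C₂) * (M.changeSet n).card * b := by
          gcongr
          nlinarith
  · calc P.real {ω | x ≤ M.maxError τhat n ω} ≤ (M.changeSet n).card * (C₁ * b) :=
          measureReal_le_maxError_le_of_forall hne fun h hh =>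
            (mem_changeSet.1 hh).2.measureReal_le_abs_sub_frac_le hp h𝔱 hC.le hc hn (hτ h hh)
              (hS h) (hτhat h hh) (minJump_pos hne) (minJump_le_jump hh) hx hnx
      _ ≤ (C₁ + C₂) * (M.changeSet n).card * b := by
          rw [← mul_assoc, mul_comm _ C₁]
          gcongr
          linarith

theorem tendstoInMeasure_maxError [IsFiniteMeasure P] {K 𝔡 : ℝ} {n₁ : ℕ} (hp : 4 ≤ p)
    (hC : 0 ≤ C) (h𝔡 : 𝔡 < p / 2 - 2)
    (h_dev : ∀ n ≥ n₁, ∀ x : ℝ, K * (Real.log n / (M.minJump n ^ 2 * n)) ≤ x →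
      P.real {ω | x ≤ M.maxError τhat n ω} ≤
        C * (M.changeSet n).card * (x * n * Real.log n) ^ (-p / 2 + 2))
    (h_dim : (fun n => (M.dim n : ℝ)) =O[atTop] (fun n : ℕ => (n : ℝ) ^ 𝔡))
    (h_lim : Tendsto (fun n : ℕ => Real.log n / (M.minJump n ^ 2 * n)) atTop (𝓝 0)) :
    TendstoInMeasure P (M.maxError τhat) atTop (fun _ => 0) := by
  rw [tendstoInMeasure_iff_measureReal_norm]
  intro ε hε
  simp only [sub_zero, Real.norm_eq_abs, abs_of_nonneg (maxError_nonneg M τhat _ _)]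
  obtain ⟨B, hB, h_dim_le⟩ := h_dim.exists_pos
  have h_threshold : ∀ᶠ n : ℕ in atTop, K * (Real.log n / (M.minJump n ^ 2 * n)) ≤ ε :=
    (h_lim.const_mul K).eventually_le_const (by simpa using hε)
  have h_vanish : Tendsto
      (fun n : ℕ => C * B * ε ^ (-p / 2 + 2) * (n : ℝ) ^ (-(p / 2 - 2 - 𝔡))) atTop (𝓝 0) := by
    simpa using ((tendsto_rpow_neg_atTop (sub_pos.2 h𝔡)).comp
      tendsto_natCast_atTop_atTop).const_mul (C * B * ε ^ (-p / 2 + 2))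
  refine squeeze_zero' (.of_forall fun n => measureReal_nonneg) ?_ h_vanish
  filter_upwards [eventually_ge_atTop n₁, eventually_gt_atTop 0, h_dim_le.bound, h_threshold,
    (Real.tendsto_log_atTop.comp tendsto_natCast_atTop_atTop).eventually_ge_atTop 1]
    with n hn hn₀ h_dim_n h_threshold_n h_log
  have hn₀ : (0 : ℝ) < n := Nat.cast_pos.2 hn₀
  have h_card : ((M.changeSet n).card : ℝ) ≤ B * (n : ℝ) ^ 𝔡 := by
    rw [Real.norm_of_nonneg (by positivity), Real.norm_of_nonneg (by positivity)] at h_dim_n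
    exact (Nat.cast_le.2 (card_changeSet_le_dim M n)).trans h_dim_n
  calc P.real {ω | ε ≤ M.maxError τhat n ω}
      ≤ C * (M.changeSet n).card * (ε * n * Real.log n) ^ (-p / 2 + 2) :=
        h_dev n hn ε h_threshold_n
    _ ≤ C * (B * (n : ℝ) ^ 𝔡) * (ε * n) ^ (-p / 2 + 2) := by
        gcongr ?_ * ?_
        · gcongr
        · exact Real.rpow_le_rpow_of_nonpos (by positivity)
            (le_mul_of_one_le_right (by positivity) h_log) (by linarith)
    _ = C * B * ε ^ (-p / 2 + 2) * (n : ℝ) ^ (-(p / 2 - 2 - 𝔡)) := by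
        rw [Real.mul_rpow hε.le hn₀.le,
          show -(p / 2 - 2 - 𝔡) = 𝔡 + (-p / 2 + 2) by ring, Real.rpow_add hn₀ 𝔡]
        ring

end Deviation

end ChangePointModel

theorem mainTheorem5_general (p 𝔞 A 𝔱 : ℝ) (hp : 4 < p) (h𝔞 : 2 + 1 / p < 𝔞) (hA : 0 < A)
    (h𝔱 : 0 < 𝔱) :
    ∃ Ca : ℝ, 0 < Ca ∧ ∀ D : ℝ, ∃ C : ℝ, 0 < C ∧
      ∀ (Ω 𝕊 : Type*) [MeasurableSpace Ω] [MeasurableSpace 𝕊]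
        (P : Measure Ω) [IsProbabilityMeasure P]
        (M : ChangePointModel Ω 𝕊) (τhat : ℕ → ℕ → Ω → ℝ) (n₁ : ℕ),
        2 ≤ n₁ →
        M.IsRegular P →
        (∀ k : ℕ, M.depMeasure P p k ≤ ENNReal.ofReal (A * (max (k : ℝ) 1) ^ (-𝔞))) →
        (∀ n ≥ n₁, (M.changeSet n).Nonempty) →
        (∀ n ≥ n₁, M.minJump n ≤ D) →
        (∀ n ≥ n₁, ∀ h ∈ M.changeSet n, M.frac n h ∈ Set.Ioo 𝔱 (1 - 𝔱)) →
        (∀ n ≥ n₁, ∀ h ∈ M.changeSet n, ∀ ω, M.IsArgmaxCusum 𝔱 n h ω (τhat n h ω)) →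
        (∀ n ≥ n₁, ∀ x : ℝ, Ca * (Real.log n / (M.minJump n ^ 2 * n)) ≤ x →
          P.real {ω | x ≤ M.maxError τhat n ω} ≤
            C * (M.changeSet n).card * (x * n * Real.log n) ^ (-p / 2 + 2)) ∧
        (∀ 𝔡 : ℝ, 𝔡 < p / 2 - 2 →
          (fun n => (M.dim n : ℝ)) =O[atTop] (fun n : ℕ => (n : ℝ) ^ 𝔡) →
          Tendsto (fun n : ℕ => Real.log n / (M.minJump n ^ 2 * n)) atTop (𝓝 0) →
          TendstoInMeasure P (M.maxError τhat) atTop (fun _ => 0)) := by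
  obtain ⟨C, c, hC, hc, h_noise⟩ :=
    ChangePointModel.exists_hasFukNagaevIncrements_noiseSum (by linarith : 2 ≤ p) h𝔞 hA
  refine ⟨2 * p / (c * (𝔱 / 48) ^ 2), by positivity, fun D => ?_⟩
  obtain ⟨C', hC', h_dev⟩ :=
    ChangePointModel.exists_measureReal_le_maxError_le hp.le h𝔱 hC hc D
  refine ⟨C', hC', fun Ω 𝕊 _ _ P _ M τhat n₁ hn₁ hM h_decay hne hD hτ hτhat => ?_⟩
  have h_bound := fun n hn => h_dev (hn₁.trans hn) (hne n hn) (hD n hn) (hτ n hn)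
    (h_noise hM h_decay) (hτhat n hn)
  exact ⟨h_bound, fun 𝔡 h𝔡 => ChangePointModel.tendstoInMeasure_maxError hp.le hC'.le h𝔡 h_bound⟩

theorem mainTheorem5 (p 𝔞 A 𝔱 : ℝ) (hp : 4 < p) (h𝔞 : 5 / 2 < 𝔞) (hA : 0 < A)
    (h𝔱 : 0 < 𝔱) (h𝔱' : 𝔱 ≤ 1 / 2) :
    ∃ Ca : ℝ, 0 < Ca ∧ ∀ D : ℝ, 0 < D → ∃ C : ℝ, 0 < C ∧
      ∀ (Ω 𝕊 : Type*) [MeasurableSpace Ω] [MeasurableSpace 𝕊]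
        (P : Measure Ω) [IsProbabilityMeasure P]
        (M : ChangePointModel Ω 𝕊) (τhat : ℕ → ℕ → Ω → ℝ) (n₁ : ℕ),
        2 ≤ n₁ →
        M.IsRegular P →
        M.TemporalAssumptions P p 𝔞 A →
        (∀ n ≥ n₁, M.Alternative n) →
        AntitoneOn M.minJump (Set.Ici n₁) →
        M.minJump n₁ ≤ D →
        (∀ n ≥ n₁, ∀ h ∈ M.changeSet n, 𝔱 < M.frac n h ∧ M.frac n h < 1 - 𝔱) →
        (∀ n ≥ n₁, ∀ h < M.dim n, ∀ ω, M.IsArgmaxCusum 𝔱 n h ω (τhat n h ω)) →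
        (∀ n ≥ n₁, ∀ x : ℝ, Ca * (Real.log n / (M.minJump n ^ 2 * n)) ≤ x →
          P.real {ω | x ≤ M.maxError τhat n ω} ≤
            C * (M.changeSet n).card * (x * n * Real.log n) ^ (-p / 2 + 2)) ∧
        (∀ 𝔡 : ℝ, 0 < 𝔡 → 𝔡 < p / 2 - 2 →
          (fun n => (M.dim n : ℝ)) =O[atTop] (fun n : ℕ => (n : ℝ) ^ 𝔡) →
          Tendsto (fun n : ℕ => Real.log n / (M.minJump n ^ 2 * n)) atTop (𝓝 0) →
          TendstoInMeasure P (M.maxError τhat) atTop (fun _ => 0)) := by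
  have h𝔞' : 2 + 1 / p < 𝔞 := by
    linarith [one_div_le_one_div_of_le (by norm_num) hp.le]
  obtain ⟨Ca, hCa, h_general⟩ := mainTheorem5_general p 𝔞 A 𝔱 hp h𝔞' hA h𝔱
  refine ⟨Ca, hCa, fun D _ => ?_⟩
  obtain ⟨C, hC, h_model⟩ := h_general D
  refine ⟨C, hC, fun Ω 𝕊 _ _ P _ M τhat n₁ hn₁ hM hT h_alt h_anti hD₁ hτ hτhat => ?_⟩
  obtain ⟨h_dev, h_consistent⟩ := h_model Ω 𝕊 P M τhat n₁ hn₁ hM hT.decay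
    (fun n hn => (h_alt n hn).1) (fun n hn => (h_anti Set.self_mem_Ici hn hn).trans hD₁) hτ
    fun n hn h hh => hτhat n hn h (ChangePointModel.mem_changeSet.1 hh).1
  exact ⟨h_dev, fun 𝔡 _ => h_consistent 𝔡⟩
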